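/- Let $\tau\ge 1$ and let $x_1,\dots,x_\tau\in\mathbb Z$ be the labels of the balls initially in an urn; put $X_i=x_i$ for $i\le\tau$. At each time $n\ge\tau$ the urn holds exactly $n$ balls, labelled $X_1,\dots,X_n$; let $\mu_n=\frac1n\sum_{i=1}^n\delta_{X_i}$ be its (random) empirical distribution. Given $X_1,\dots,X_n$, two balls are drawn independently, uniformly and with replacement from the urn, and a new ball, whose label $X_{n+1}$ is the sum of the two drawn labels, is added. Let $Z_n$ denote a random draw from the urn at time $n$, i.e. the conditional law of $Z_n$ given $\mu_n$ is $\mu_n$. Then: 1. The limit $A=\lim_{n\to\infty}\frac{\mathbb E[Z_n\mid\mu_n]}{n+1}$, where $\mathbb E[Z_n\mid\mu_n]=\int z\,\mu_n(dz)=\frac1n\sum_{i=1}^n X_i$, exists almost surely (and is finite). 2. If the initial labels are not all equal to $0$, then $\mathbb P(A\ne 0)>0$. 3. (Quenched limit law.) Almost surely, i.e. for almost every realization of the urn process, the conditional law of $Z_n/n$ given $\mu_n$ converges weakly, as $n\to\infty$, to the law of $A\cdot E$, where $A$ is the value of the limit in part 1 for this realization and $E\sim\mathrm{Exp}(1)$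 (this law is $\delta_0$ when $A=0$). -/

import Mathlib

open MeasureTheory ProbabilityTheory Filter Topology
open scoped ENNReal BoundedContinuousFunction

noncomputable section

namespace ZUrn

variable {Ω : Type*}

/-- The empirical distribution `μ_n` of the urn when it holds `n` balls: the balls are
labelled `X 0 ω, …, X (n - 1) ω`, and each of them carries mass `1 / n`. -/
def empirical (X : ℕ → Ω → ℤ) (n : ℕ) (ω : Ω) : Measure ℤ :=
  (n : ℝ≥0∞)⁻¹ • ∑ i ∈ Finset.range n, Measure.dirac (X i ω)

/-- The σ-algebra generated by the first `n` balls. -/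
abbrev history (X : ℕ → Ω → ℤ) (n : ℕ) : MeasurableSpace Ω :=
  MeasurableSpace.comap (fun ω (i : Fin n) => X i ω) inferInstance

/-- The σ-algebra generated by the random measure `μ_n`. -/
abbrev empiricalSigma (X : ℕ → Ω → ℤ) (n : ℕ) : MeasurableSpace Ω :=
  MeasurableSpace.comap (empirical X n) inferInstance

/-- `X` is the sequence of labels of a `ℤ`-urn with initial labels `x 0, …, x (τ - 1)`:
given the first `n ≥ τ` balls, the label of the next ball is distributed as the sum `p.1 + p.2`
of two independent draws from `μ_n`. -/
structure IsZUrn [MeasurableSpace Ω] (P : Measure Ω) {τ : ℕ} (x : Fin τ → ℤ)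
    (X : ℕ → Ω → ℤ) : Prop where
  measurable : ∀ i, Measurable (X i)
  initial : ∀ i : Fin τ, ∀ᵐ ω ∂P, X i ω = x i
  step : ∀ n, τ ≤ n → ∀ z : ℤ,
    P⟦X n ⁻¹' {z} | history X n⟧ =ᵐ[P]
      fun ω => ((empirical X n ω).prod (empirical X n ω)).real {p : ℤ × ℤ | p.1 + p.2 = z}

/-- For every `n ≥ τ`, the variable `Z n` is a random draw from the urn at time `n`: its
conditional distribution given `μ_n` is `μ_n`. -/
structure IsDraw [MeasurableSpace Ω] (P : Measure Ω) (τ : ℕ) (X Z : ℕ → Ω → ℤ) : Prop where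
  measurable : ∀ n, Measurable (Z n)
  law : ∀ n, τ ≤ n → ∀ z : ℤ,
    P⟦Z n ⁻¹' {z} | empiricalSigma X n⟧ =ᵐ[P] fun ω => (empirical X n ω).real {z}

/-- Weak convergence of a sequence of laws on `ℝ`. -/
def WeakTendsto (ν : ℕ → Measure ℝ) (ν' : Measure ℝ) : Prop :=
  ∀ f : ℝ →ᵇ ℝ, Tendsto (fun n => ∫ y, f y ∂(ν n)) atTop (𝓝 (∫ y, f y ∂ν'))

/-- The law of `a · Exp(1)`. -/
def scaledExp (a : ℝ) : Measure ℝ := (expMeasure 1).map (fun e => a * e)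

end ZUrn

end

/-! Write `S_n` and `Q_n` for the sums of the first `n` labels and of their squares. Given the past,
the next label has mean `2 S_n / n`, so `S_n / (n (n + 1))` is a martingale. The second moments of
the new label close up into a linear recursion for `E S_n ^ 2` and `E Q_n`, which gives bounds of
order `n ^ 4` and `n ^ 3` (`IsZUrn.exists_moment_bound`). The martingale is thus bounded in `L²` and
converges almost surely and in `L¹` to a limit `A`. If `A` vanished almost surely, the martingale
would vanish at every time, hence so would the first new label; its second moment is then `2 ∑ x_i ^
2 / τ`, which forces all initial labels to be `0`.

For the limit law, put `C_n(θ) = ∑_{k < n} exp (i θ X_k)`. Since the sum of two independent draws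
has the squared characteristic function, `C_{n+1} = C_n + (C_n / n) ^ 2 + noise`. With `φ(t) = 1 /
(1 - i a t)`, the characteristic function of `a · Exp(1)`, the function `s φ(θ s)` solves the
corresponding equation `F' = (F / s) ^ 2`. The difference of the two therefore obeys a linear
recursion of rate at most `2 / n`, so an error made after time `m` is amplified up to time `N` by at
most about `(N / m) ^ 2` (`norm_le_of_recursion`).

Take `θ = t / N` and `m` about `N ^ (9 / 10)`. At time `m` the angles `θ X_k` are small on average,
and a Taylor expansion compares `C_m(θ)` with `m φ(θ m)` through `S_m` and `Q_m`. Between `m` and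
`N` the noise is at most `N ^ (3 / 4)` by an exponential martingale bound and Borel–Cantelli
(`IsZUrn.ae_eventually_abs_noise_lt`). After amplification all errors are `o(N)`, so `C_N(t / N) /
N` tends to `φ(t)` (`tendsto_charSum_div`). This holds almost surely for all rational `t`; a random
Lipschitz bound, from the supermartingale of the absolute labels, extends it to real `t`, and Lévy's
continuity theorem concludes. -/

namespace ZUrn

/-! ### Conditional laws of integer variables through their atoms -/

section Atoms

variable {Ω : Type*} {m m0 : MeasurableSpace Ω} {P : Measure Ω} [IsProbabilityMeasure P]

/-- If the conditional probabilities of the atoms outside `[-B, B]` vanish, then the variable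
is almost surely bounded by `B`. -/
lemma ae_abs_le_of_condExp_atoms (hm : m ≤ m0) {Y : Ω → ℤ}
    (hY : Measurable Y) {q : Ω → ℤ → ℝ}
    (h : ∀ z, P⟦Y ⁻¹' {z} | m⟧ =ᵐ[P] fun ω => q ω z) {B : ℕ}
    (hq : ∀ z : ℤ, (B : ℤ) < |z| → ∀ᵐ ω ∂P, q ω z = 0) : ∀ᵐ ω ∂P, |Y ω| ≤ B := by
  have key : ∀ z : ℤ, (B : ℤ) < |z| → ∀ᵐ ω ∂P, Y ω ≠ z := by
    intro z hz
    have h1 : ∫ ω, (Y ⁻¹' {z}).indicator (fun _ => (1 : ℝ)) ω ∂P = 0 := by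
      rw [← integral_condExp hm]
      apply integral_eq_zero_of_ae
      filter_upwards [h z, hq z hz] with ω h1 h2
      rw [h1, h2]; rfl
    have h2 := integral_indicator_one (μ := P) (hY (measurableSet_singleton z))
    simp only [Pi.one_def] at h2
    rw [h2] at h1
    rw [measureReal_eq_zero_iff] at h1
    rw [ae_iff]
    convert h1 using 2
    ext ω; simp
  have : ∀ᵐ ω ∂P, ∀ z : ℤ, (B : ℤ) < |z| → Y ω ≠ z := by
    rw [ae_all_iff]
    intro z
    by_cases hz : (B : ℤ) < |z|
    · filter_upwards [key z hz] with ω hω _ using hω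
    · exact ae_of_all _ fun ω hh => absurd hh hz
  filter_upwards [this] with ω hω
  by_contra hcon
  exact hω _ (not_le.1 hcon) rfl

/-- Conditional expectations of functions of a bounded integer variable from the conditional
probabilities of its atoms. -/
lemma condExp_comp_of_atoms {Y : Ω → ℤ}
    (hY : Measurable Y) {q : Ω → ℤ → ℝ}
    (h : ∀ z, P⟦Y ⁻¹' {z} | m⟧ =ᵐ[P] fun ω => q ω z) {B : ℕ}
    (hB : ∀ᵐ ω ∂P, |Y ω| ≤ B) (g : ℤ → ℝ) :
    P[fun ω => g (Y ω) | m] =ᵐ[P] fun ω => ∑ z ∈ Finset.Icc (-(B : ℤ)) B, g z * q ω z := by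
  have h1 : (fun ω => g (Y ω)) =ᵐ[P]
      ∑ z ∈ Finset.Icc (-(B : ℤ)) B, g z • (Y ⁻¹' {z}).indicator (fun _ => (1 : ℝ)) := by
    filter_upwards [hB] with ω hω
    rw [Finset.sum_apply, Finset.sum_eq_single (Y ω)]
    · simp
    · intro z _ hz
      simp [Set.indicator, hz.symm]
    · intro hh
      exact absurd (Finset.mem_Icc.2 (abs_le.1 hω)) hh
  refine (condExp_congr_ae h1).trans ?_
  refine (condExp_finsetSum (fun z _ => ?_) m).trans ?_
  · exact ((integrable_const (1 : ℝ)).indicator (hY (measurableSet_singleton z))).smul _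
  have h2 : ∀ z, P[g z • (Y ⁻¹' {z}).indicator (fun _ => (1 : ℝ)) | m] =ᵐ[P]
      fun ω => g z * q ω z := by
    intro z
    refine (condExp_smul _ _ m).trans ?_
    filter_upwards [h z] with ω hω
    simp [hω]
  have h3 := ae_all_iff.2 h2
  filter_upwards [h3] with ω hω
  simp [Finset.sum_apply, hω]

end Atoms

/-! ### The empirical measure and averages over pairs of balls -/

section Empirical

variable {Ω : Type*}

lemma isProbabilityMeasure_empirical (X : ℕ → Ω → ℤ) {n : ℕ} (hn : n ≠ 0) (ω : Ω) :
    IsProbabilityMeasure (empirical X n ω) := by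
  constructor
  simp [empirical, Measure.finsetSum_apply, ENNReal.inv_mul_cancel, hn]

lemma integral_empirical {E : Type*} [NormedAddCommGroup E] [NormedSpace ℝ E] [CompleteSpace E]
    (X : ℕ → Ω → ℤ) (n : ℕ) (ω : Ω) (f : ℤ → E) :
    ∫ z, f z ∂(empirical X n ω) = (n : ℝ)⁻¹ • ∑ i ∈ Finset.range n, f (X i ω) := by
  rw [empirical, integral_smul_measure, integral_finsetSum_measure]
  · simp
  · intro i _
    exact integrable_dirac (by simp)

lemma empirical_real (X : ℕ → Ω → ℤ) (n : ℕ) (ω : Ω) (s : Set ℤ) [DecidablePred (· ∈ s)] :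
    (empirical X n ω).real s
      = (n : ℝ)⁻¹ * ∑ i ∈ Finset.range n, if X i ω ∈ s then (1 : ℝ) else 0 := by
  rw [← integral_indicator_one (MeasurableSet.of_discrete), integral_empirical]
  simp [Set.indicator]

/-- The mean of `g` over the label of the new ball when the urn holds `n` balls. -/
noncomputable def pairMean (g : ℤ → ℝ) (X : ℕ → Ω → ℤ) (n : ℕ) (ω : Ω) : ℝ :=
  (n : ℝ)⁻¹ * ∑ i ∈ Finset.range n, (n : ℝ)⁻¹ * ∑ j ∈ Finset.range n, g (X i ω + X j ω)

lemma empirical_prod_real (X : ℕ → Ω → ℤ) {n : ℕ} (hn : n ≠ 0) (ω : Ω) (z : ℤ) :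
    ((empirical X n ω).prod (empirical X n ω)).real {p : ℤ × ℤ | p.1 + p.2 = z}
      = pairMean (fun y => if y = z then 1 else 0) X n ω := by
  have := isProbabilityMeasure_empirical X hn ω
  rw [measureReal_def, Measure.prod_apply MeasurableSet.of_discrete,
    ← integral_toReal (measurable_from_top).aemeasurable (ae_of_all _ fun x => measure_lt_top _ _),
    integral_empirical]
  simp only [pairMean, smul_eq_mul]
  congr 1
  refine Finset.sum_congr rfl fun i _ => ?_
  classical
  rw [← measureReal_def, empirical_real]
  simp only [Set.mem_preimage, Set.mem_ofPred_eq]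

lemma measurable_history {X : ℕ → Ω → ℤ} {n i : ℕ} (hi : i < n) : Measurable[history X n] (X i) :=
  (measurable_pi_apply (⟨i, hi⟩ : Fin n)).comp
    (comap_measurable (fun ω (i : Fin n) => X i ω))

lemma pairMean_atom_eq_zero {X : ℕ → Ω → ℤ} {n B : ℕ} {ω : Ω} (h : ∀ i < n, |X i ω| ≤ B) {z : ℤ}
    (hz : (2 * B : ℤ) < |z|) : pairMean (fun y => if y = z then 1 else 0) X n ω = 0 := by
  unfold pairMean
  rw [Finset.sum_eq_zero, mul_zero]
  intro i hi
  rw [Finset.sum_eq_zero, mul_zero]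
  intro j hj
  refine if_neg ?_
  rintro rfl
  have h1 := h i (Finset.mem_range.1 hi)
  have h2 := h j (Finset.mem_range.1 hj)
  have h3 := abs_add_le (X i ω) (X j ω)
  omega

lemma history_mono {X : ℕ → Ω → ℤ} : Monotone (history X) := by
  intro n k hnk
  have h : Measurable[history X k] (fun ω (i : Fin n) => X i ω) :=
    @measurable_pi_lambda _ _ _ (history X k) _ _ fun i =>
      measurable_history (lt_of_lt_of_le i.2 hnk)
  exact Measurable.comap_le h

end Empirical

/-! ### Boundedness of labels and the one-step conditional law -/

section Urn

variable {Ω : Type*} [MeasurableSpace Ω] {P : Measure Ω}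
  {τ : ℕ} {x : Fin τ → ℤ} {X : ℕ → Ω → ℤ}

lemma history_le (hX : ∀ i, Measurable (X i)) (n : ℕ) : history X n ≤ ‹MeasurableSpace Ω› :=
  Measurable.comap_le (measurable_pi_lambda _ fun i => hX i)

lemma exists_bound_range {n : ℕ} (h : ∀ i < n, ∃ B : ℕ, ∀ᵐ ω ∂P, |X i ω| ≤ B) :
    ∃ B : ℕ, ∀ᵐ ω ∂P, ∀ i < n, |X i ω| ≤ B := by
  choose! B hB using h
  refine ⟨∑ i ∈ Finset.range n, B i, ?_⟩
  rw [ae_all_iff]; intro i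
  by_cases hi : i < n
  · filter_upwards [hB i hi] with ω hω _
    refine hω.trans ?_
    exact_mod_cast Finset.single_le_sum (f := B) (fun _ _ => Nat.zero_le _)
      (Finset.mem_range.2 hi)
  · exact ae_of_all _ fun ω h => absurd h hi

variable [IsProbabilityMeasure P] (hX : IsZUrn P x X)
include hX

/-- A new label is a sum of two old ones, so the bound at most doubles at each step. This reduces
all later conditional expectations to finite sums and settles every integrability question. -/
lemma IsZUrn.exists_bound (hτ : 0 < τ) (n : ℕ) : ∃ B : ℕ, ∀ᵐ ω ∂P, |X n ω| ≤ B := by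
  induction n using Nat.strong_induction_on with
  | _ n ih =>
  by_cases hn : n < τ
  · refine ⟨(x ⟨n, hn⟩).natAbs, ?_⟩
    filter_upwards [hX.initial ⟨n, hn⟩] with ω hω
    simp [hω]
  · obtain ⟨B, hB⟩ := exists_bound_range ih
    refine ⟨2 * B, ae_abs_le_of_condExp_atoms (history_le hX.measurable n) (hX.measurable n)
      (q := fun ω z => ((empirical X n ω).prod (empirical X n ω)).real {p : ℤ × ℤ | p.1 + p.2 = z})
      (fun z => hX.step n (not_lt.1 hn) z) ?_⟩
    intro z hz
    filter_upwards [hB] with ω hω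
    rw [empirical_prod_real X (by omega)]
    exact pairMean_atom_eq_zero hω (by exact_mod_cast hz)

lemma IsZUrn.exists_bound_lt (hτ : 0 < τ) (n : ℕ) :
    ∃ B : ℕ, ∀ᵐ ω ∂P, ∀ i < n, |X i ω| ≤ B :=
  exists_bound_range fun i _ => hX.exists_bound hτ i

/-- The conditional expectation of a function of the new label. -/
lemma IsZUrn.condExp_next (hτ : 0 < τ) {n : ℕ} (hn : τ ≤ n) (g : ℤ → ℝ) :
    P[fun ω => g (X n ω) | history X n] =ᵐ[P] pairMean g X n := by
  obtain ⟨B, hB⟩ := hX.exists_bound_lt hτ (n + 1)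
  have hn0 : n ≠ 0 := by omega
  -- The window `[-2B, 2B]` contains all sums `X i + X j` of old labels, so no atom of the pair law
  -- is lost in the finite sum.
  refine (condExp_comp_of_atoms (hX.measurable n) (hX.step n hn) (B := 2 * B)
    (by
      filter_upwards [hB] with ω hω
      have := hω n (by omega)
      push_cast
      linarith [abs_nonneg (X n ω)]) g).trans ?_
  filter_upwards [hB] with ω hω
  simp_rw [empirical_prod_real X hn0, pairMean, Finset.mul_sum]
  rw [Finset.sum_comm]
  refine Finset.sum_congr rfl fun i hi => ?_
  rw [Finset.sum_comm]
  refine Finset.sum_congr rfl fun j hj => ?_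
  rw [Finset.sum_eq_single (X i ω + X j ω)]
  · simp; ring
  · intro z _ hz; simp [hz.symm]
  · intro hh
    exfalso; apply hh
    have h1 := hω i (by have := Finset.mem_range.1 hi; omega)
    have h2 := hω j (by have := Finset.mem_range.1 hj; omega)
    rw [abs_le] at h1 h2
    rw [Finset.mem_Icc]; push_cast; constructor <;> linarith

end Urn

/-! ### Functions of the first labels; algebra of pair averages -/

section History

variable {Ω : Type*} {X : ℕ → Ω → ℤ} {n k : ℕ} {F G : Ω → ℝ}

/-- `F` is a function of the first `n` labels. -/
def DependsOnFirst (X : ℕ → Ω → ℤ) (n : ℕ) (F : Ω → ℝ) : Prop :=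
  ∀ ⦃ω ω'⦄, (∀ i < n, X i ω = X i ω') → F ω = F ω'

/-- The sum of `g` over the first `n` labels. -/
noncomputable def total (g : ℤ → ℝ) (X : ℕ → Ω → ℤ) (n : ℕ) (ω : Ω) : ℝ :=
  ∑ i ∈ Finset.range n, g (X i ω)

lemma total_succ (g : ℤ → ℝ) (X : ℕ → Ω → ℤ) (n : ℕ) (ω : Ω) :
    total g X (n + 1) ω = total g X n ω + g (X n ω) := Finset.sum_range_succ _ _

lemma DependsOnFirst.mono (hF : DependsOnFirst X n F) (h : n ≤ k) : DependsOnFirst X k F :=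
  fun _ _ hh => hF fun i hi => hh i (hi.trans_le h)

lemma dependsOnFirst_const (c : ℝ) : DependsOnFirst X n (fun _ => c) := fun _ _ _ => rfl

lemma dependsOnFirst_total (g : ℤ → ℝ) : DependsOnFirst X n (total g X n) := fun _ _ h =>
  Finset.sum_congr rfl fun i hi => by rw [h i (Finset.mem_range.1 hi)]

lemma dependsOnFirst_pairMean (g : ℤ → ℝ) : DependsOnFirst X n (pairMean g X n) := by
  intro ω ω' h
  unfold pairMean
  congr 1
  refine Finset.sum_congr rfl fun i hi => ?_
  congr 1
  refine Finset.sum_congr rfl fun j hj => ?_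
  rw [h i (Finset.mem_range.1 hi), h j (Finset.mem_range.1 hj)]

lemma dependsOnFirst_label (g : ℤ → ℝ) : DependsOnFirst X (n + 1) (fun ω => g (X n ω)) :=
  fun _ _ h => by simp only [h n (Nat.lt_succ_self n)]

lemma DependsOnFirst.comp (hF : DependsOnFirst X n F) (φ : ℝ → ℝ) :
    DependsOnFirst X n (fun ω => φ (F ω)) := fun _ _ h => by simp only [hF h]

lemma DependsOnFirst.comp₂ (hF : DependsOnFirst X n F) (hG : DependsOnFirst X n G)
    (φ : ℝ → ℝ → ℝ) : DependsOnFirst X n (fun ω => φ (F ω) (G ω)) :=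
  fun _ _ h => by simp only [hF h, hG h]

lemma DependsOnFirst.mul (hF : DependsOnFirst X n F) (hG : DependsOnFirst X n G) :
    DependsOnFirst X n (fun ω => F ω * G ω) := hF.comp₂ hG (· * ·)

lemma DependsOnFirst.eq_comp (hF : DependsOnFirst X n F) :
    ∃ Φ : (Fin n → ℤ) → ℝ, ∀ ω, F ω = Φ (fun i => X i ω) := by
  have h : Function.FactorsThrough F (fun ω (i : Fin n) => X i ω) := by
    intro ω ω' hh
    exact hF fun i hi => congrFun hh ⟨i, hi⟩
  exact ⟨Function.extend (fun ω (i : Fin n) => X i ω) F 0, fun ω => (h.extend_apply 0 ω).symm⟩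

/-- The space `Fin n → ℤ` is countable, so every function on it is measurable. Adaptedness thus
becomes a purely combinatorial condition. -/
lemma DependsOnFirst.stronglyMeasurable (hF : DependsOnFirst X n F) :
    StronglyMeasurable[history X n] F := by
  obtain ⟨Φ, hΦ⟩ := hF.eq_comp
  have h : F = Φ ∘ (fun ω (i : Fin n) => X i ω) := funext hΦ
  rw [h]
  exact (Measurable.stronglyMeasurable (measurable_of_countable Φ)).comp_measurable
    (comap_measurable _)

lemma pairMean_add (g h : ℤ → ℝ) (X : ℕ → Ω → ℤ) (n : ℕ) (ω : Ω) :
    pairMean (fun z => g z + h z) X n ω = pairMean g X n ω + pairMean h X n ω := by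
  simp [pairMean, Finset.sum_add_distrib, mul_add]

lemma pairMean_mul_left (c : ℝ) (g : ℤ → ℝ) (X : ℕ → Ω → ℤ) (n : ℕ) (ω : Ω) :
    pairMean (fun z => c * g z) X n ω = c * pairMean g X n ω := by
  simp only [pairMean, Finset.mul_sum]
  refine Finset.sum_congr rfl fun i _ => Finset.sum_congr rfl fun j _ => by ring

lemma pairMean_const (c : ℝ) (X : ℕ → Ω → ℤ) (hn : n ≠ 0) (ω : Ω) :
    pairMean (fun _ => c) X n ω = c := by
  have : (n : ℝ) ≠ 0 := by exact_mod_cast hn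
  simp [pairMean]; field_simp

lemma pairMean_mono {g h : ℤ → ℝ} (hgh : ∀ z, g z ≤ h z) (X : ℕ → Ω → ℤ) (n : ℕ) (ω : Ω) :
    pairMean g X n ω ≤ pairMean h X n ω := by
  unfold pairMean
  gcongr
  exact hgh _

lemma pairMean_id (X : ℕ → Ω → ℤ) (hn : n ≠ 0) (ω : Ω) :
    pairMean (fun z => (z : ℝ)) X n ω = 2 * total (fun z => (z : ℝ)) X n ω / n := by
  have : (n : ℝ) ≠ 0 := by exact_mod_cast hn
  simp only [pairMean, total, Int.cast_add, Finset.sum_add_distrib, Finset.sum_const,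
    Finset.card_range, nsmul_eq_mul, mul_add, ← Finset.mul_sum]
  field_simp
  ring

lemma pairMean_sq (X : ℕ → Ω → ℤ) (hn : n ≠ 0) (ω : Ω) :
    pairMean (fun z => (z : ℝ) ^ 2) X n ω = 2 * total (fun z => (z : ℝ) ^ 2) X n ω / n
      + 2 * (total (fun z => (z : ℝ)) X n ω) ^ 2 / n ^ 2 := by
  have : (n : ℝ) ≠ 0 := by exact_mod_cast hn
  simp only [pairMean, total, Int.cast_add, add_sq, Finset.sum_add_distrib, Finset.sum_const,
    Finset.card_range, nsmul_eq_mul, mul_add, ← Finset.mul_sum, ← Finset.sum_mul]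
  field_simp
  ring

lemma pairMean_abs_le (X : ℕ → Ω → ℤ) (hn : n ≠ 0) (ω : Ω) :
    pairMean (fun z => |(z : ℝ)|) X n ω ≤ 2 * total (fun z => |(z : ℝ)|) X n ω / n := by
  have h0 : (n : ℝ) ≠ 0 := by exact_mod_cast hn
  have : pairMean (fun z => |(z : ℝ)|) X n ω ≤ (n : ℝ)⁻¹ * ∑ i ∈ Finset.range n, (n : ℝ)⁻¹ *
      ∑ j ∈ Finset.range n, (|(X i ω : ℝ)| + |(X j ω : ℝ)|) := by
    unfold pairMean
    gcongr
    push_cast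
    exact abs_add_le _ _
  refine this.trans (le_of_eq ?_)
  simp only [total, Finset.sum_add_distrib, Finset.sum_const,
    Finset.card_range, nsmul_eq_mul, mul_add, ← Finset.mul_sum]
  field_simp
  ring

end History

/-! ### Second moments -/

section Moments

variable {Ω : Type*} [MeasurableSpace Ω] {P : Measure Ω} [IsProbabilityMeasure P]
  {τ : ℕ} {x : Fin τ → ℤ} {X : ℕ → Ω → ℤ} {n : ℕ} {F : Ω → ℝ}
  (hX : IsZUrn P x X) (hτ : 0 < τ)
include hX hτ

/-- Almost surely the first `n` labels lie in a finite box of `ℤ ^ n`, on which any function is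
bounded. -/
lemma IsZUrn.integrable (hF : DependsOnFirst X n F) : Integrable F P := by
  obtain ⟨B, hB⟩ := hX.exists_bound_lt hτ n
  obtain ⟨Φ, hΦ⟩ := hF.eq_comp
  have hfin : (Set.Icc (fun _ => -(B : ℤ)) (fun _ => (B : ℤ)) : Set (Fin n → ℤ)).Finite :=
    Set.finite_Icc _ _
  obtain ⟨C, hC⟩ := (hfin.image fun h => ‖Φ h‖).bddAbove
  refine Integrable.of_bound (C := C)
    (hF.stronglyMeasurable.mono (history_le hX.measurable n)).aestronglyMeasurable ?_
  filter_upwards [hB] with ω hω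
  refine hC ⟨fun i => X i ω, ⟨fun i => ?_, fun i => ?_⟩, ?_⟩
  · exact (abs_le.1 (hω i i.2)).1
  · exact (abs_le.1 (hω i i.2)).2
  · simp only [hΦ]

lemma IsZUrn.condExp_mul_next (hn : τ ≤ n) (hF : DependsOnFirst X n F) (g : ℤ → ℝ) :
    P[fun ω => F ω * g (X n ω) | history X n] =ᵐ[P] fun ω => F ω * pairMean g X n ω := by
  have h := condExp_mul_of_stronglyMeasurable_left (μ := P) (m := history X n)
    (f := F) (g := fun ω => g (X n ω)) hF.stronglyMeasurable
    (hX.integrable hτ ((hF.mono n.le_succ).mul (dependsOnFirst_label g)))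
    (hX.integrable hτ (dependsOnFirst_label g))
  refine h.trans ?_
  filter_upwards [hX.condExp_next hτ hn g] with ω hω
  simp [hω]

lemma IsZUrn.integral_mul_next (hn : τ ≤ n) (hF : DependsOnFirst X n F) (g : ℤ → ℝ) :
    ∫ ω, F ω * g (X n ω) ∂P = ∫ ω, F ω * pairMean g X n ω ∂P := by
  rw [← integral_condExp (history_le hX.measurable n)]
  exact integral_congr_ae (hX.condExp_mul_next hτ hn hF g)

lemma IsZUrn.integral_next (hn : τ ≤ n) (g : ℤ → ℝ) :
    ∫ ω, g (X n ω) ∂P = ∫ ω, pairMean g X n ω ∂P := by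
  simpa using hX.integral_mul_next hτ hn (dependsOnFirst_const 1) g

/-- Together with the next recursion this is a closed linear system in the second moment of the
total and the mean sum of squares. -/
lemma IsZUrn.integral_total_sq_succ (hn : τ ≤ n) :
    ∫ ω, total (fun z => (z : ℝ) ^ 2) X (n + 1) ω ∂P
      = (1 + 2 / n) * ∫ ω, total (fun z => (z : ℝ) ^ 2) X n ω ∂P
        + 2 / n ^ 2 * ∫ ω, total (fun z => (z : ℝ)) X n ω ^ 2 ∂P := by
  have hn0 : n ≠ 0 := by omega
  have i1 := hX.integrable hτ (dependsOnFirst_total (X := X) (n := n) fun z => (z : ℝ) ^ 2)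
  have i2 := hX.integrable hτ
    ((dependsOnFirst_total (X := X) (n := n) fun z => (z : ℝ)).comp (· ^ 2))
  simp_rw [total_succ]
  rw [integral_add i1 (hX.integrable hτ (dependsOnFirst_label fun z => (z : ℝ) ^ 2)),
    hX.integral_next hτ hn fun z => (z : ℝ) ^ 2]
  simp_rw [pairMean_sq X hn0, mul_div_right_comm]
  rw [integral_add (i1.const_mul _) (i2.const_mul _), integral_const_mul, integral_const_mul]
  ring

lemma IsZUrn.integral_total_id_sq_succ (hn : τ ≤ n) :
    ∫ ω, total (fun z => (z : ℝ)) X (n + 1) ω ^ 2 ∂P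
      = (1 + 4 / n + 2 / n ^ 2) * ∫ ω, total (fun z => (z : ℝ)) X n ω ^ 2 ∂P
        + 2 / n * ∫ ω, total (fun z => (z : ℝ) ^ 2) X n ω ∂P := by
  have hn0 : n ≠ 0 := by omega
  have d := dependsOnFirst_total (X := X) (n := n) fun z => (z : ℝ)
  have i1 := hX.integrable hτ (dependsOnFirst_total (X := X) (n := n) fun z => (z : ℝ) ^ 2)
  have i2 := hX.integrable hτ (d.comp (· ^ 2))
  have i3 := hX.integrable hτ ((d.comp (2 * ·)).mono n.le_succ |>.mul
    (dependsOnFirst_label fun z => (z : ℝ)))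
  simp_rw [total_succ, add_sq]
  have i23 : Integrable (fun ω => total (fun z => (z : ℝ)) X n ω ^ 2
      + 2 * total (fun z => (z : ℝ)) X n ω * (X n ω : ℝ)) P := i2.add i3
  rw [integral_add i23 (hX.integrable hτ (dependsOnFirst_label fun z => (z : ℝ) ^ 2)),
    integral_add i2 i3, hX.integral_next hτ hn fun z => (z : ℝ) ^ 2,
    hX.integral_mul_next hτ hn (d.comp (2 * ·)) fun z => (z : ℝ)]
  simp_rw [pairMean_sq X hn0, pairMean_id X hn0, mul_div_right_comm]
  rw [integral_add (i1.const_mul _) (i2.const_mul _), integral_const_mul, integral_const_mul]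
  have : ∀ ω, 2 * total (fun z => (z : ℝ)) X n ω * (2 / n * total (fun z => (z : ℝ)) X n ω)
      = 4 / n * total (fun z => (z : ℝ)) X n ω ^ 2 := fun ω => by ring
  simp_rw [this]
  rw [integral_const_mul]
  ring

/-- Second moment bounds for the urn. -/
lemma IsZUrn.exists_moment_bound : ∃ C : ℝ, 0 ≤ C ∧ ∀ n, τ ≤ n →
    ∫ ω, total (fun z => (z : ℝ)) X n ω ^ 2 ∂P ≤ C * n ^ 4 ∧
    ∫ ω, total (fun z => (z : ℝ) ^ 2) X n ω ∂P ≤ 2 * C * n ^ 3 := by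
  set a := fun n => ∫ ω, total (fun z => (z : ℝ)) X n ω ^ 2 ∂P with ha
  set b := fun n => ∫ ω, total (fun z => (z : ℝ) ^ 2) X n ω ∂P with hb
  have ha0 : 0 ≤ a τ := integral_nonneg fun ω => sq_nonneg _
  have hb0 : 0 ≤ b τ := integral_nonneg fun ω => Finset.sum_nonneg fun i _ => sq_nonneg _
  -- The relative factor `2` between the two bounds is what closes the induction: the recursions
  -- then produce `C (n ^ 4 + 4 n ^ 3 + 6 n ^ 2)` and `2 C (n ^ 3 + 3 n ^ 2)`, the leading terms of
  -- the binomial expansions of `C (n + 1) ^ 4` and `2 C (n + 1) ^ 3`.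
  refine ⟨a τ + b τ, by positivity, fun n hn => ?_⟩
  change a n ≤ _ ∧ b n ≤ _
  induction n, hn using Nat.le_induction with
  | base =>
    have h1 : (1 : ℝ) ≤ τ := by exact_mod_cast hτ
    have h4 := one_le_pow₀ h1 (n := 4)
    have h3 := one_le_pow₀ h1 (n := 3)
    constructor <;> nlinarith
  | succ n hn ih =>
    obtain ⟨iha, ihb⟩ := ih
    have ra : a (n + 1) = (1 + 4 / n + 2 / n ^ 2) * a n + 2 / n * b n :=
      hX.integral_total_id_sq_succ hτ hn
    have rb : b (n + 1) = (1 + 2 / n) * b n + 2 / n ^ 2 * a n :=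
      hX.integral_total_sq_succ hτ hn
    set C := a τ + b τ
    have hC : 0 ≤ C := by positivity
    have hn0 : (0 : ℝ) < n := by exact_mod_cast (by omega : 0 < n)
    rw [ra, rb]
    push_cast
    constructor
    · calc (1 + 4 / n + 2 / n ^ 2) * a n + 2 / n * b n
          ≤ (1 + 4 / n + 2 / n ^ 2) * (C * n ^ 4) + 2 / n * (2 * C * n ^ 3) := by gcongr
        _ = C * ((n : ℝ) ^ 4 + 4 * n ^ 3 + 6 * n ^ 2) := by field_simp; ring
        _ ≤ C * (n + 1) ^ 4 := by gcongr; nlinarith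
    · calc (1 + 2 / n) * b n + 2 / n ^ 2 * a n
          ≤ (1 + 2 / n) * (2 * C * n ^ 3) + 2 / n ^ 2 * (C * n ^ 4) := by gcongr
        _ = 2 * C * ((n : ℝ) ^ 3 + 3 * n ^ 2) := by field_simp; ring
        _ ≤ 2 * C * (n + 1) ^ 3 := by gcongr; nlinarith

end Moments

/-! ### Uniform integrability from second moments -/

section UniformIntegrability

variable {Ω ι : Type*} [MeasurableSpace Ω] {P : Measure Ω} [IsFiniteMeasure P]

/-- A family that is bounded in `L²` is uniformly integrable. -/
lemma uniformIntegrable_of_integral_sq_le {f : ι → Ω → ℝ} (hf : ∀ i, AEStronglyMeasurable (f i) P)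
    (hint : ∀ i, Integrable (fun ω => f i ω ^ 2) P) {C : ℝ} (hC : ∀ i, ∫ ω, f i ω ^ 2 ∂P ≤ C) :
    UniformIntegrable f 1 P := by
  refine uniformIntegrable_of le_rfl ENNReal.one_ne_top hf fun ε hε => ?_
  -- Where `|f| ≥ K` one has `|f| ≤ f ^ 2 / K`, so the tail integral is at most `C / K`; the `+ 1`
  -- keeps `K` positive.
  refine ⟨⟨(|C| + 1) / ε, by positivity⟩, fun i => ?_⟩
  set K : ℝ := (|C| + 1) / ε with hK
  have hKpos : 0 < K := by positivity
  rw [eLpNorm_one_eq_lintegral_enorm]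
  calc ∫⁻ ω, ‖({ω | (⟨K, hKpos.le⟩ : NNReal) ≤ ‖f i ω‖₊}.indicator (f i)) ω‖ₑ ∂P
      ≤ ∫⁻ ω, ENNReal.ofReal (K⁻¹ * f i ω ^ 2) ∂P := by
        refine lintegral_mono fun ω => ?_
        by_cases h : K ≤ ‖f i ω‖
        · rw [Set.indicator_of_mem (by exact h), ← ofReal_norm]
          refine ENNReal.ofReal_le_ofReal ?_
          rw [Real.norm_eq_abs] at h ⊢
          rw [inv_mul_eq_div, le_div_iff₀ hKpos, ← sq_abs, sq]
          gcongr
        · rw [Set.indicator_of_notMem (by exact h)]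
          simp
    _ = ENNReal.ofReal (∫ ω, K⁻¹ * f i ω ^ 2 ∂P) := by
        rw [ofReal_integral_eq_lintegral_ofReal ((hint i).const_mul _)
          (ae_of_all _ fun ω => by positivity)]
    _ ≤ ENNReal.ofReal ε := by
        refine ENNReal.ofReal_le_ofReal ?_
        rw [integral_const_mul, hK, inv_div]
        rw [div_mul_eq_mul_div, div_le_iff₀ (by positivity)]
        have := hC i
        have := le_abs_self C
        nlinarith

end UniformIntegrability

/-! ### The martingale of rescaled totals and its limit -/

section Martingale

variable {Ω : Type*} [MeasurableSpace Ω] {P : Measure Ω}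
  {τ : ℕ} {x : Fin τ → ℤ} {X : ℕ → Ω → ℤ}

/-- The filtration of the urn, started at time `τ`. -/
def historyFiltration (hX : ∀ i, Measurable (X i)) (τ : ℕ) :
    Filtration ℕ ‹MeasurableSpace Ω› where
  seq k := history X (k + τ)
  mono' _ _ h := history_mono (Nat.add_le_add_right h τ)
  le' k := history_le hX (k + τ)

/-- The sum of `g` over the first `n` labels, divided by `n * (n + 1)`. -/
noncomputable def scaledTotal (g : ℤ → ℝ) (X : ℕ → Ω → ℤ) (n : ℕ) (ω : Ω) : ℝ :=
  ((n : ℝ) * (n + 1))⁻¹ * total g X n ω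

omit [MeasurableSpace Ω] in
lemma dependsOnFirst_scaledTotal (g : ℤ → ℝ) (n : ℕ) :
    DependsOnFirst X n (scaledTotal g X n) :=
  (dependsOnFirst_total g).comp (((n : ℝ) * (n + 1))⁻¹ * ·)

variable [IsProbabilityMeasure P] (hX : IsZUrn P x X) (hτ : 0 < τ)
include hX hτ

lemma IsZUrn.condExp_scaledTotal_succ {n : ℕ} (hn : τ ≤ n) (g : ℤ → ℝ) :
    P[scaledTotal g X (n + 1) | history X n] =ᵐ[P]
      fun ω => (((n : ℝ) + 1) * (n + 2))⁻¹ * (total g X n ω + pairMean g X n ω) := by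
  have d : DependsOnFirst X n (fun ω => (((n : ℝ) + 1) * (n + 2))⁻¹ * total g X n ω) :=
    (dependsOnFirst_total g).comp ((((n : ℝ) + 1) * (n + 2))⁻¹ * ·)
  have e : scaledTotal g X (n + 1) = (fun ω => (((n : ℝ) + 1) * (n + 2))⁻¹ * total g X n ω)
      + fun ω => (((n : ℝ) + 1) * (n + 2))⁻¹ * g (X n ω) := by
    funext ω
    simp only [scaledTotal, total_succ, Pi.add_apply]
    push_cast
    ring
  rw [e]
  refine (condExp_add (hX.integrable hτ d) (hX.integrable hτ
    ((dependsOnFirst_const _).mul (dependsOnFirst_label g))) _).trans ?_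
  rw [condExp_of_stronglyMeasurable (history_le hX.measurable n) d.stronglyMeasurable
    (hX.integrable hτ d)]
  filter_upwards [hX.condExp_mul_next hτ hn
    (dependsOnFirst_const (((n : ℝ) + 1) * (n + 2))⁻¹) g] with ω hω
  rw [Pi.add_apply, hω]
  ring

/-- The total grows on average by the factor `1 + 2 / n = (n + 2) / n`, which is exactly the growth
of `n (n + 1)`. -/
lemma IsZUrn.martingale_scaledTotal : Martingale
    (fun k => scaledTotal (fun z => (z : ℝ)) X (k + τ)) (historyFiltration hX.measurable τ) P := by
  refine martingale_nat (fun k => (dependsOnFirst_scaledTotal _ _).stronglyMeasurable)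
    (fun k => hX.integrable hτ (dependsOnFirst_scaledTotal _ _)) fun k => ?_
  have h := hX.condExp_scaledTotal_succ hτ (n := k + τ) (by omega) fun z => (z : ℝ)
  rw [show k + 1 + τ = k + τ + 1 by ring]
  refine EventuallyEq.trans (ae_of_all _ fun ω => ?_) h.symm
  have hn0 : k + τ ≠ 0 := by omega
  simp only [scaledTotal]
  rw [pairMean_id X hn0]
  have : (0 : ℝ) < ((k + τ : ℕ) : ℝ) := by exact_mod_cast Nat.pos_of_ne_zero hn0
  field_simp

/-- By the triangle inequality the rescaled absolute total is a supermartingale. Its convergence is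
later used only as a bound, the Lipschitz constant of the empirical characteristic functions. -/
lemma IsZUrn.submartingale_neg_scaledTotal_abs : Submartingale
    (fun k ω => -scaledTotal (fun z => |(z : ℝ)|) X (k + τ) ω)
    (historyFiltration hX.measurable τ) P := by
  refine submartingale_nat
    (fun k => ((dependsOnFirst_scaledTotal _ _).comp (- ·)).stronglyMeasurable)
    (fun k => hX.integrable hτ ((dependsOnFirst_scaledTotal _ _).comp (- ·))) fun k => ?_
  have h := hX.condExp_scaledTotal_succ hτ (n := k + τ) (by omega) fun z => |(z : ℝ)|
  have h2 := condExp_neg (μ := P) (scaledTotal (fun z => |(z : ℝ)|) X (k + τ + 1))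
    (history X (k + τ))
  rw [show k + 1 + τ = k + τ + 1 by ring]
  filter_upwards [h, h2] with ω h h2
  refine le_of_le_of_eq ?_ h2.symm
  rw [Pi.neg_apply, h, neg_le_neg_iff]
  have hn0 : k + τ ≠ 0 := by omega
  have hp : (0 : ℝ) < ((k + τ : ℕ) : ℝ) := by exact_mod_cast Nat.pos_of_ne_zero hn0
  have h3 := pairMean_abs_le X hn0 ω
  set n := k + τ
  calc _ ≤ (((n : ℝ) + 1) * (n + 2))⁻¹ * (total (fun z => |(z : ℝ)|) X n ω
        + 2 * total (fun z => |(z : ℝ)|) X n ω / n) := by gcongr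
    _ = _ := by
      simp only [scaledTotal]
      field_simp

lemma IsZUrn.uniformIntegrable_scaledTotal : UniformIntegrable
    (fun k => scaledTotal (fun z => (z : ℝ)) X (k + τ)) 1 P := by
  obtain ⟨C, hC0, hC⟩ := hX.exists_moment_bound hτ
  refine uniformIntegrable_of_integral_sq_le (C := C)
    (fun k => (hX.integrable hτ (dependsOnFirst_scaledTotal _ _)).aestronglyMeasurable)
    (fun k => hX.integrable hτ ((dependsOnFirst_scaledTotal _ _).comp (· ^ 2))) fun k => ?_
  set n := k + τ
  have hp : (0 : ℝ) < (n : ℝ) := by exact_mod_cast (by omega : 0 < k + τ)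
  simp only [scaledTotal, mul_pow]
  rw [integral_const_mul]
  calc _ ≤ (((n : ℝ) * (n + 1))⁻¹) ^ 2 * (C * n ^ 4) := by
        gcongr; exact (hC n (by omega)).1
    _ = C * ((n : ℝ) ^ 2 / (n + 1) ^ 2) := by field_simp
    _ ≤ C * 1 := by
        gcongr
        rw [div_le_one (by positivity)]
        gcongr; linarith
    _ = C := mul_one C

/-- Cauchy–Schwarz bounds the square of the absolute total by `n` times the sum of squares, whose
mean is `O(n ^ 3)`. -/
lemma IsZUrn.uniformIntegrable_neg_scaledTotal_abs : UniformIntegrable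
    (fun k ω => -scaledTotal (fun z => |(z : ℝ)|) X (k + τ) ω) 1 P := by
  obtain ⟨C, hC0, hC⟩ := hX.exists_moment_bound hτ
  refine uniformIntegrable_of_integral_sq_le (C := 2 * C)
    (fun k => (hX.integrable hτ
      ((dependsOnFirst_scaledTotal _ _).comp (- ·))).aestronglyMeasurable)
    (fun k => hX.integrable hτ ((dependsOnFirst_scaledTotal _ _).comp fun y => (-y) ^ 2))
    fun k => ?_
  set n := k + τ
  have hp : (0 : ℝ) < (n : ℝ) := by exact_mod_cast (by omega : 0 < k + τ)
  have hle : ∀ ω, (-scaledTotal (fun z => |(z : ℝ)|) X n ω) ^ 2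
      ≤ (((n : ℝ) * (n + 1))⁻¹) ^ 2 * (n * total (fun z => (z : ℝ) ^ 2) X n ω) := by
    intro ω
    rw [neg_sq, scaledTotal, mul_pow]
    gcongr
    have := sq_sum_le_card_mul_sum_sq (s := Finset.range n) (f := fun i => |(X i ω : ℝ)|)
    simpa [total] using this
  have dq := dependsOnFirst_total (X := X) (n := n) fun z => (z : ℝ) ^ 2
  refine (integral_mono (hX.integrable hτ ((dependsOnFirst_scaledTotal _ _).comp fun y => (-y) ^ 2))
    (hX.integrable hτ (dq.comp fun y => (((n : ℝ) * (n + 1))⁻¹) ^ 2 * (n * y))) hle).trans ?_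
  rw [integral_const_mul, integral_const_mul]
  calc _ ≤ (((n : ℝ) * (n + 1))⁻¹) ^ 2 * (n * (2 * C * n ^ 3)) := by
        gcongr; exact (hC n (by omega)).2
    _ = 2 * C * ((n : ℝ) ^ 2 / (n + 1) ^ 2) := by field_simp
    _ ≤ 2 * C * 1 := by
        gcongr
        rw [div_le_one (by positivity)]
        gcongr; linarith
    _ = 2 * C := mul_one _

/-- The rescaled mean absolute label stays bounded. -/
lemma IsZUrn.ae_exists_scaledTotal_abs_le : ∀ᵐ ω ∂P, ∃ C : ℝ, ∀ n, τ ≤ n →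
    scaledTotal (fun z => |(z : ℝ)|) X n ω ≤ C := by
  obtain ⟨R, hR⟩ := (hX.uniformIntegrable_neg_scaledTotal_abs hτ).2.2
  filter_upwards [(hX.submartingale_neg_scaledTotal_abs hτ).exists_ae_tendsto_of_bdd hR]
    with ω ⟨c, hω⟩
  obtain ⟨C, hC⟩ := hω.bddBelow_range
  refine ⟨-C, fun n hn => ?_⟩
  have := hC ⟨n - τ, rfl⟩
  simp only [Nat.sub_add_cancel hn] at this
  linarith

/-- The rescaled means converge almost surely. -/
lemma IsZUrn.exists_limit : ∃ A : Ω → ℝ, Measurable A ∧ ∀ᵐ ω ∂P,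
    Tendsto (fun n => scaledTotal (fun z => (z : ℝ)) X n ω) atTop (𝓝 (A ω)) := by
  obtain ⟨R, hR⟩ := (hX.uniformIntegrable_scaledTotal hτ).2.2
  obtain ⟨A, hA, h⟩ := exists_stronglyMeasurable_limit_of_tendsto_ae
    (fun n => (hX.uniformIntegrable_scaledTotal hτ).1 n)
    ((hX.martingale_scaledTotal hτ).submartingale.exists_ae_tendsto_of_bdd hR)
  refine ⟨A, hA.measurable, h.mono fun ω hω => ?_⟩
  exact (tendsto_add_atTop_iff_nat (f := fun n => scaledTotal (fun z => (z : ℝ)) X n ω) τ).1 hω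

/-- The limit does not vanish identically unless the initial labels do. -/
lemma IsZUrn.limit_ne_zero {A : Ω → ℝ} (hlim : ∀ᵐ ω ∂P,
      Tendsto (fun n => scaledTotal (fun z => (z : ℝ)) X n ω) atTop (𝓝 (A ω)))
    (hx : ∃ i, x i ≠ 0) : 0 < P {ω | A ω ≠ 0} := by
  rw [pos_iff_ne_zero]
  intro h0
  have hA : A =ᵐ[P] 0 := h0
  have hL1 := tendsto_Lp_finite_of_tendsto_ae le_rfl ENNReal.one_ne_top
    (hX.uniformIntegrable_scaledTotal hτ).1 (MemLp.zero (ε := ℝ))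
    (hX.uniformIntegrable_scaledTotal hτ).2.1 (by
      filter_upwards [hlim, hA] with ω h1 h2
      rw [h2] at h1
      exact h1.comp (tendsto_add_atTop_nat τ))
  -- A martingale converging in `L¹` consists of the conditional expectations of its limit, here
  -- `0`.
  have hS : ∀ n, τ ≤ n → ∀ᵐ ω ∂P, total (fun z => (z : ℝ)) X n ω = 0 := by
    intro n hn
    have h1 := (hX.martingale_scaledTotal hτ).eq_condExp_of_tendsto_eLpNorm
      (integrable_zero _ _ _) hL1 (n - τ)
    rw [condExp_zero] at h1
    filter_upwards [h1] with ω hω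
    simp only [Nat.sub_add_cancel hn, scaledTotal, Pi.zero_apply] at hω
    have hp : (0 : ℝ) < (n : ℝ) := by exact_mod_cast (by omega : 0 < n)
    simpa [hp.ne', (by positivity : (n : ℝ) + 1 ≠ 0)] using hω
  -- Vanishing totals at times `τ` and `τ + 1` force the first new label to be `0`, whereas its
  -- second moment is computed below from the initial labels, the squared total dropping out.
  have hXτ : ∫ ω, (X τ ω : ℝ) ^ 2 ∂P = 0 := by
    apply integral_eq_zero_of_ae
    filter_upwards [hS τ le_rfl, hS (τ + 1) (by omega)] with ω h1 h2
    rw [total_succ, h1] at h2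
    have h3 : (X τ ω : ℝ) = 0 := by simpa using h2
    simp [h3]
  rw [hX.integral_next hτ le_rfl fun z => (z : ℝ) ^ 2] at hXτ
  have hae : ∀ᵐ ω ∂P, pairMean (fun z => (z : ℝ) ^ 2) X τ ω
      = 2 * (∑ i, (x i : ℝ) ^ 2) / τ := by
    filter_upwards [hS τ le_rfl, ae_all_iff.2 hX.initial] with ω h1 h2
    rw [pairMean_sq X (by omega), h1, total, Finset.sum_range]
    simp [h2]
  rw [integral_congr_ae hae] at hXτ
  obtain ⟨i, hi⟩ := hx
  have hpos : 0 < ∑ i, (x i : ℝ) ^ 2 := by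
    refine Finset.sum_pos' (fun i _ => sq_nonneg _) ⟨i, Finset.mem_univ _, ?_⟩
    have : (x i : ℝ) ≠ 0 := by exact_mod_cast hi
    positivity
  have hp : (0 : ℝ) < (τ : ℝ) := by exact_mod_cast hτ
  simp at hXτ
  rcases hXτ with h | h
  · exact hpos.ne' h
  · omega

end Martingale

/-! ### Concentration of the noise and growth of the sums of squares -/

section Noise

variable {Ω : Type*}

/-- The accumulated difference between `g` at the new labels and its conditional mean. -/
noncomputable def noise (g : ℤ → ℝ) (X : ℕ → Ω → ℤ) (τ n : ℕ) (ω : Ω) : ℝ :=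
  ∑ k ∈ Finset.Ico τ n, (g (X k ω) - pairMean g X k ω)

lemma noise_succ (g : ℤ → ℝ) (X : ℕ → Ω → ℤ) {τ n : ℕ} (hn : τ ≤ n) (ω : Ω) :
    noise g X τ (n + 1) ω = noise g X τ n ω + (g (X n ω) - pairMean g X n ω) :=
  Finset.sum_Ico_succ_top hn _

lemma dependsOnFirst_noise (g : ℤ → ℝ) (X : ℕ → Ω → ℤ) (τ n : ℕ) :
    DependsOnFirst X n (noise g X τ n) := by
  intro ω ω' h
  refine Finset.sum_congr rfl fun k hk => ?_
  have hk := (Finset.mem_Ico.1 hk).2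
  rw [h k hk, dependsOnFirst_pairMean g fun i hi => h i (hi.trans hk)]

/-- Averaging `exp y ≤ 1 + y + y ^ 2`, valid for `|y| ≤ 1`, and then using `1 + y ≤ exp y`. This is
the one-step factor in the exponential moment of the noise. -/
lemma pairMean_exp_le {g : ℤ → ℝ} (hg : ∀ z, |g z| ≤ 1) {l : ℝ} (hl : |l| ≤ 1)
    (X : ℕ → Ω → ℤ) {n : ℕ} (hn : n ≠ 0) (ω : Ω) :
    pairMean (fun z => Real.exp (l * g z)) X n ω ≤ Real.exp (l * pairMean g X n ω + l ^ 2) := by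
  have h1 : ∀ z, Real.exp (l * g z) ≤ l * g z + (1 + l ^ 2) := by
    intro z
    have ha : |l * g z| ≤ 1 := by
      rw [abs_mul]; exact mul_le_one₀ hl (abs_nonneg _) (hg z)
    have hb := (abs_le.1 (Real.abs_exp_sub_one_sub_id_le ha)).2
    have hc : (l * g z) ^ 2 ≤ l ^ 2 := by
      rw [mul_pow, ← sq_abs (g z)]
      exact mul_le_of_le_one_right (sq_nonneg l) (pow_le_one₀ (abs_nonneg _) (hg z))
    linarith
  refine (pairMean_mono h1 X n ω).trans ?_
  rw [pairMean_add, pairMean_const _ X hn, pairMean_mul_left]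
  have := Real.add_one_le_exp (l * pairMean g X n ω + l ^ 2)
  linarith

variable [MeasurableSpace Ω] {P : Measure Ω} [IsProbabilityMeasure P]
  {τ : ℕ} {x : Fin τ → ℤ} {X : ℕ → Ω → ℤ} (hX : IsZUrn P x X) (hτ : 0 < τ)
include hX hτ

/-- Conditioning on the first `n` labels, each centred increment costs at most a factor `exp (l ^
2)`. -/
lemma IsZUrn.mgf_noise_le {g : ℤ → ℝ} (hg : ∀ z, |g z| ≤ 1) {l : ℝ} (hl : |l| ≤ 1) {n : ℕ}
    (hn : τ ≤ n) : mgf (noise g X τ n) P l ≤ Real.exp (l ^ 2 * n) := by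
  induction n, hn using Nat.le_induction with
  | base => simp [mgf, noise]; positivity
  | succ n hn ih =>
    have hn0 : n ≠ 0 := by omega
    have d := (dependsOnFirst_noise g X τ n).comp₂ (dependsOnFirst_pairMean g)
      (fun a b => Real.exp (l * (a - b)))
    have e : ∀ ω, Real.exp (l * noise g X τ (n + 1) ω)
        = Real.exp (l * (noise g X τ n ω - pairMean g X n ω)) * Real.exp (l * g (X n ω)) := by
      intro ω
      rw [noise_succ g X hn, ← Real.exp_add]
      ring_nf
    simp only [mgf, e]
    rw [hX.integral_mul_next hτ hn d fun z => Real.exp (l * g z)]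
    calc _ ≤ ∫ ω, Real.exp (l ^ 2) * Real.exp (l * noise g X τ n ω) ∂P := by
          refine integral_mono (hX.integrable hτ (d.mul (dependsOnFirst_pairMean _)))
            (hX.integrable hτ ((dependsOnFirst_noise g X τ n).comp
              fun a => Real.exp (l ^ 2) * Real.exp (l * a))) fun ω => ?_
          refine (mul_le_mul_of_nonneg_left (pairMean_exp_le hg hl X hn0 ω)
            (Real.exp_pos _).le).trans (le_of_eq ?_)
          rw [← Real.exp_add, ← Real.exp_add]
          ring_nf
      _ ≤ Real.exp (l ^ 2) * Real.exp (l ^ 2 * n) := by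
          rw [integral_const_mul]
          gcongr
          exact ih
      _ = Real.exp (l ^ 2 * (n + 1 : ℕ)) := by
          rw [← Real.exp_add]; push_cast; ring_nf

/-- Chernoff's bound for both tails. The parameter `l` stays free, to be tuned to the time horizon.
-/
lemma IsZUrn.measureReal_le_abs_noise {g : ℤ → ℝ} (hg : ∀ z, |g z| ≤ 1) {l : ℝ} (hl0 : 0 ≤ l)
    (hl : l ≤ 1) {n : ℕ} (hn : τ ≤ n) (u : ℝ) :
    P.real {ω | u ≤ |noise g X τ n ω|} ≤ 2 * Real.exp (l ^ 2 * n - l * u) := by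
  have hi : ∀ l : ℝ, Integrable (fun ω => Real.exp (l * noise g X τ n ω)) P := fun l =>
    hX.integrable hτ ((dependsOnFirst_noise g X τ n).comp fun a => Real.exp (l * a))
  have h1 := measure_ge_le_exp_mul_mgf u hl0 (hi l)
  have h2 := measure_le_le_exp_mul_mgf (-u) (neg_nonpos.2 hl0) (hi (-l))
  have h3 := hX.mgf_noise_le hτ hg (l := l) (by rwa [abs_of_nonneg hl0]) hn
  have h4 := hX.mgf_noise_le hτ hg (l := -l) (by rwa [abs_neg, abs_of_nonneg hl0]) hn
  rw [neg_sq] at h4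
  have hsub : {ω | u ≤ |noise g X τ n ω|}
      ⊆ {ω | u ≤ noise g X τ n ω} ∪ {ω | noise g X τ n ω ≤ -u} := by
    intro ω hω
    rcases le_abs.1 (show u ≤ |noise g X τ n ω| from hω) with h | h
    · exact Or.inl h
    · exact Or.inr (show noise g X τ n ω ≤ -u by linarith)
  have h5 := (measureReal_mono (μ := P) hsub).trans (measureReal_union_le _ _)
  have e : Real.exp (l ^ 2 * n - l * u) = Real.exp (-l * u) * Real.exp (l ^ 2 * n) := by
    rw [← Real.exp_add]; ring_nf
  have h6 := mul_le_mul_of_nonneg_left h3 (Real.exp_pos (-l * u)).le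
  have h7 := mul_le_mul_of_nonneg_left h4 (Real.exp_pos (-l * u)).le
  rw [e]
  rw [show - -l * -u = -l * u by ring] at h2
  linarith

/-- Along any sequence of test functions, the noise up to time `N` is `O(N ^ (3 / 4))`. -/
lemma IsZUrn.ae_eventually_abs_noise_lt {g : ℕ → ℤ → ℝ} (hg : ∀ N z, |g N z| ≤ 1) :
    ∀ᵐ ω ∂P, ∀ᶠ N : ℕ in atTop, ∀ n, τ ≤ n → n ≤ N → |noise (g N) X τ n ω| < √N * √√N := by
  set s : ℕ → Set Ω := fun N => ⋃ n ∈ Finset.Icc τ N, {ω | √N * √√N ≤ |noise (g N) X τ n ω|}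
    with hs
  have hbound : ∀ N, P (s N) ≤
      ENNReal.ofReal (4 * Real.exp 1 * (12).factorial * ((N : ℝ) ^ 2)⁻¹) := by
    intro N
    -- At `N = 0` the right-hand side is `0` because `0⁻¹ = 0`; the union is empty since `τ` is
    -- positive.
    rcases Nat.eq_zero_or_pos N with rfl | hN
    · have : s 0 = ∅ := by
        rw [hs]; simp [Finset.Icc_eq_empty (by omega : ¬ τ ≤ 0)]
      simp [this]
    have hN1 : (1 : ℝ) ≤ N := by exact_mod_cast hN
    have hw : (0 : ℝ) < √√N := by positivity
    have hw4 : √√(N : ℝ) ^ 4 = N := by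
      rw [show (4 : ℕ) = 2 * 2 by rfl, pow_mul, Real.sq_sqrt (by positivity),
        Real.sq_sqrt (by positivity)]
    have hNs : √(N : ℝ) ^ 2 = N := Real.sq_sqrt (by positivity)
    have hs0 : 0 < √(N : ℝ) := by positivity
    rw [← ENNReal.ofReal_toReal (measure_ne_top P (s N)), ← measureReal_def]
    refine ENNReal.ofReal_le_ofReal ?_
    refine (measureReal_biUnion_finset_le _ _).trans ?_
    have hterm : ∀ n ∈ Finset.Icc τ N, P.real {ω | √N * √√N ≤ |noise (g N) X τ n ω|}
        ≤ 2 * (Real.exp 1 * ((12).factorial * ((N : ℝ) ^ 3)⁻¹)) := by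
      intro n hn
      obtain ⟨hn1, hn2⟩ := Finset.mem_Icc.1 hn
      -- With `l = N ^ (-1 / 2)` the term `l ^ 2 n` is at most `1` and `l u` equals `w = N ^ (1 /
      -- 4)`. Then `exp (-w) ≤ 12! / w ^ 12 = 12! / N ^ 3`, which leaves a summable `N ^ (-2)` after
      -- the union over `n`.
      refine (hX.measureReal_le_abs_noise hτ (hg N) (l := (√N)⁻¹) (by positivity)
        (inv_le_one_of_one_le₀ (Real.one_le_sqrt.2 hN1)) hn1 _).trans ?_
      gcongr
      rw [sub_eq_add_neg, Real.exp_add]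
      have h1 : ((√N)⁻¹) ^ 2 * (n : ℝ) ≤ 1 := by
        rw [inv_pow, hNs, inv_mul_le_iff₀ (by positivity), mul_one]
        exact_mod_cast hn2
      have h2 : (√N)⁻¹ * (√N * √√(N : ℝ)) = √√N := by field_simp
      rw [h2]
      gcongr
      have h3 := Real.pow_div_factorial_le_exp (√√(N : ℝ)) hw.le 12
      rw [show (12 : ℕ) = 4 * 3 by rfl, pow_mul, hw4] at h3
      rw [Real.exp_neg]
      calc (Real.exp √√(N : ℝ))⁻¹ ≤ ((N : ℝ) ^ 3 / (4 * 3).factorial)⁻¹ := by gcongr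
        _ = _ := by rw [inv_div, div_eq_mul_inv]
    refine (Finset.sum_le_card_nsmul _ _ _ hterm).trans ?_
    rw [nsmul_eq_mul, Nat.card_Icc]
    have hc : ((N + 1 - τ : ℕ) : ℝ) ≤ 2 * N := by
      have : N + 1 - τ ≤ 2 * N := by omega
      exact_mod_cast this
    calc _ ≤ (2 * N) * (2 * (Real.exp 1 * ((12).factorial * ((N : ℝ) ^ 3)⁻¹))) := by gcongr
      _ = _ := by field_simp; ring
  have hsum : ∑' N, P (s N) ≠ ∞ := by
    refine ne_top_of_le_ne_top ?_ (ENNReal.tsum_le_tsum hbound)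
    exact (((Real.summable_nat_pow_inv.2 one_lt_two).mul_left _).tsum_ofReal_ne_top)
  filter_upwards [ae_eventually_notMem hsum] with ω hω
  filter_upwards [hω] with N hN n hn1 hn2
  by_contra hcon
  refine hN ?_
  simp only [hs, Set.mem_iUnion]
  exact ⟨n, Finset.mem_Icc.2 ⟨hn1, hn2⟩, not_lt.1 hcon⟩

/-- The sums of squared labels along the eighteenth powers grow at most like `N ^ (28 / 9)`. -/
lemma IsZUrn.ae_tendsto_total_sq : ∀ᵐ ω ∂P,
    Tendsto (fun K : ℕ => total (fun z => (z : ℝ) ^ 2) X (K ^ 18) ω / (K : ℝ) ^ 56)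
      atTop (𝓝 0) := by
  obtain ⟨C, hC0, hC⟩ := hX.exists_moment_bound hτ
  -- The mean of the sum of squares at time `K ^ 18` is `O(K ^ 54)`; dividing by two more powers of
  -- `K` makes the expectations summable, so almost surely the terms tend to `0`.
  set Y : ℕ → Ω → ℝ := fun K ω => total (fun z => (z : ℝ) ^ 2) X (K ^ 18) ω / (K : ℝ) ^ 56
  have hY0 : ∀ K ω, 0 ≤ Y K ω := fun K ω =>
    div_nonneg (Finset.sum_nonneg fun i _ => sq_nonneg _) (by positivity)
  have hYi : ∀ K, Integrable (Y K) P := fun K =>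
    hX.integrable hτ ((dependsOnFirst_total _).comp (· / (K : ℝ) ^ 56))
  have hb : ∀ k, ∫⁻ ω, ENNReal.ofReal (Y (k + τ) ω) ∂P
      ≤ ENNReal.ofReal (2 * C * (((k + τ : ℕ) : ℝ) ^ 2)⁻¹) := by
    intro k
    rw [← ofReal_integral_eq_lintegral_ofReal (hYi _) (ae_of_all _ (hY0 _))]
    refine ENNReal.ofReal_le_ofReal ?_
    set K := k + τ
    have hK : (0 : ℝ) < K := by exact_mod_cast (by omega : 0 < k + τ)
    have hτK : τ ≤ K ^ 18 := (by omega : τ ≤ K).trans (Nat.le_self_pow (by norm_num) K)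
    simp only [Y]
    rw [integral_div]
    calc _ ≤ (2 * C * ((K ^ 18 : ℕ) : ℝ) ^ 3) / (K : ℝ) ^ 56 := by
          gcongr; exact (hC _ hτK).2
      _ = _ := by push_cast; field_simp
  have hsum : ∫⁻ ω, ∑' k, ENNReal.ofReal (Y (k + τ) ω) ∂P ≠ ∞ := by
    rw [lintegral_tsum fun k => (hYi _).aemeasurable.ennreal_ofReal]
    refine ne_top_of_le_ne_top ?_ (ENNReal.tsum_le_tsum hb)
    have h := (summable_nat_add_iff τ).2 (Real.summable_nat_pow_inv.2 one_lt_two)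
    exact (h.mul_left (2 * C)).tsum_ofReal_ne_top
  have hae := ae_lt_top' (AEMeasurable.tsum
    fun k => (hYi (k + τ)).aemeasurable.ennreal_ofReal) hsum
  filter_upwards [hae] with ω hω
  have h1 := ENNReal.tendsto_atTop_zero_of_tsum_ne_top hω.ne
  have h2 := (ENNReal.tendsto_toReal ENNReal.zero_ne_top).comp h1
  refine (tendsto_add_atTop_iff_nat (f := fun K => Y K ω) τ).1 ?_
  refine h2.congr fun k => ?_
  simp [ENNReal.toReal_ofReal (hY0 _ _)]

end Noise

/-! ### Deterministic estimates: discrete Grönwall and the exponential characteristic function -/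

section Deterministic

/-- A discrete Grönwall inequality with rate `2 / n`. -/
lemma norm_le_of_recursion {E c d : ℕ → ℂ} {m N : ℕ} (hm : 0 < m) {B : ℝ}
    (hrec : ∀ n, m ≤ n → n < N → E (n + 1) = E n + c n * E n / n + d n)
    (hc : ∀ n, m ≤ n → n < N → ‖c n‖ ≤ 2)
    (hd : ∀ n, m ≤ n → n ≤ N → ‖E m + ∑ k ∈ Finset.Ico m n, d k‖ ≤ B)
    {n : ℕ} (hmn : m ≤ n) (hnN : n ≤ N) :
    ‖E n‖ ≤ B * ((n : ℝ) * (n + 1) / (m * (m + 1))) := by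
  -- `R` dominates `‖E n‖` and satisfies `R (n + 1) ≤ (1 + 2 / n) R n`; the product of these factors
  -- telescopes to `n (n + 1) / (m (m + 1))`. Only partial sums of `d` enter, so cancellation in the
  -- noise is kept.
  set R : ℕ → ℝ := fun n => B + ∑ k ∈ Finset.Ico m n, 2 * ‖E k‖ / k with hR
  have hER : ∀ n, m ≤ n → n ≤ N → ‖E n‖ ≤ R n := by
    intro n hmn hnN
    have e : ∀ n, m ≤ n → n ≤ N → E n = (E m + ∑ k ∈ Finset.Ico m n, d k)
        + ∑ k ∈ Finset.Ico m n, c k * E k / k := by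
      intro n hmn
      induction n, hmn using Nat.le_induction with
      | base => simp
      | succ n hmn ih =>
        intro hn
        rw [Finset.sum_Ico_succ_top hmn, Finset.sum_Ico_succ_top hmn, hrec n hmn (by omega)]
        nth_rw 1 [ih (by omega)]
        ring
    rw [e n hmn hnN]
    refine (norm_add_le _ _).trans (add_le_add (hd n hmn hnN) ?_)
    refine (norm_sum_le _ _).trans (Finset.sum_le_sum fun k hk => ?_)
    obtain ⟨h1, h2⟩ := Finset.mem_Ico.1 hk
    rw [norm_div, norm_mul, Complex.norm_natCast]
    gcongr
    exact hc k h1 (by omega)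
  refine (hER n hmn hnN).trans ?_
  induction n, hmn using Nat.le_induction with
  | base =>
    have : (0 : ℝ) < m := by exact_mod_cast hm
    simp [hR, div_self (by positivity : (m : ℝ) * (m + 1) ≠ 0)]
  | succ n hmn ih =>
    have hn0 : (0 : ℝ) < n := by exact_mod_cast (by omega : 0 < n)
    have hm0 : (0 : ℝ) < m := by exact_mod_cast hm
    have h1 := hER n hmn (by omega)
    have h2 := ih (by omega)
    have e : R (n + 1) = R n + 2 * ‖E n‖ / n := by
      simp only [hR]
      rw [Finset.sum_Ico_succ_top hmn]
      ring
    rw [e]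
    calc R n + 2 * ‖E n‖ / n ≤ R n + 2 * R n / n := by gcongr
      _ = (1 + 2 / n) * R n := by ring
      _ ≤ (1 + 2 / n) * (B * ((n : ℝ) * (n + 1) / (m * (m + 1)))) := by gcongr
      _ = B * (((n + 1 : ℕ) : ℝ) * ((n + 1 : ℕ) + 1) / (m * (m + 1))) := by
        push_cast
        field_simp
        ring

/-- The characteristic function of the exponential law scaled by `a`. -/
noncomputable def expChar (a t : ℝ) : ℂ := (1 - a * t * Complex.I)⁻¹

lemma one_le_norm_one_sub (a t : ℝ) : 1 ≤ ‖1 - a * t * Complex.I‖ := by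
  have := Complex.abs_re_le_norm (1 - a * t * Complex.I)
  simpa using this

lemma one_sub_ne_zero (a t : ℝ) : 1 - a * t * Complex.I ≠ 0 := by
  rw [← norm_pos_iff]; linarith [one_le_norm_one_sub a t]

lemma expChar_mul (a t : ℝ) : expChar a t * (1 - a * t * Complex.I) = 1 :=
  inv_mul_cancel₀ (one_sub_ne_zero a t)

lemma norm_expChar_le (a t : ℝ) : ‖expChar a t‖ ≤ 1 := by
  rw [expChar, norm_inv]
  exact inv_le_one_of_one_le₀ (one_le_norm_one_sub a t)

lemma continuous_expChar (a : ℝ) : Continuous (expChar a) := by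
  unfold expChar
  exact Continuous.inv₀ (by fun_prop) (one_sub_ne_zero a)

/-- The function `s ↦ s * expChar a (θ * s)` solves `F' = (F / s) ^ 2`, so this is the error of one
Euler step of length `1`. -/
lemma norm_expChar_recursion_le (a θ : ℝ) (n : ℕ) :
    ‖((n : ℂ) + 1) * expChar a (θ * (n + 1)) - n * expChar a (θ * n) - expChar a (θ * n) ^ 2‖
      ≤ |a * θ| * (1 + n * |a * θ|) := by
  have h1 := norm_expChar_le a (θ * (n + 1))
  have h2 := norm_expChar_le a (θ * n)
  have e : ((n : ℂ) + 1) * expChar a (θ * (n + 1)) - n * expChar a (θ * n) - expChar a (θ * n) ^ 2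
      = (a * θ : ℝ) * Complex.I * expChar a (θ * n) * expChar a (θ * (n + 1))
        + n * ((a * θ : ℝ) * Complex.I) ^ 2 * expChar a (θ * n) ^ 2 * expChar a (θ * (n + 1)) := by
    have h1 := expChar_mul a (θ * n)
    have h2 := expChar_mul a (θ * (n + 1))
    generalize expChar a (θ * n) = p at h1 ⊢
    generalize expChar a (θ * (n + 1)) = q at h2 ⊢
    push_cast at h1 h2 ⊢
    -- The resolvent identity for `p` and `q`, the reciprocals of `1 - i a θ n` and `1 - i a θ (n +
    -- 1)`.
    have hA : q - p = a * θ * Complex.I * p * q := by linear_combination -q * h1 + p * h2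
    have hB : p - p ^ 2 = -(a * θ * Complex.I) * n * p ^ 2 := by linear_combination -p * h1
    linear_combination ((n : ℂ) + 1 + n * (a * θ * Complex.I) * p) * hA + hB
  rw [e]
  generalize a * θ = c
  refine (norm_add_le _ _).trans ?_
  simp only [norm_mul, norm_pow, Complex.norm_I, Complex.norm_real, Complex.norm_natCast,
    Real.norm_eq_abs, mul_one]
  have h3 : |c| * ‖expChar a (θ * n)‖ * ‖expChar a (θ * (n + 1))‖ ≤ |c| * 1 * 1 := by
    gcongr
  have h4 : n * |c| ^ 2 * ‖expChar a (θ * n)‖ ^ 2 * ‖expChar a (θ * (n + 1))‖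
      ≤ n * |c| ^ 2 * 1 ^ 2 * 1 := by gcongr
  linarith

/-- Taylor's bound serves for `|y| ≤ 1`; for `|y| ≥ 1` the two pieces are at most `|y|` each, whence
the constant `2`. -/
lemma norm_exp_mul_I_sub_sub_le (y : ℝ) :
    ‖Complex.exp (y * Complex.I) - 1 - y * Complex.I‖ ≤ 2 * y ^ 2 := by
  rcases le_total |y| 1 with h | h
  · have : ‖(y : ℂ) * Complex.I‖ ≤ 1 := by simpa using h
    have h2 := Complex.norm_exp_sub_one_sub_id_le this
    have h3 : ‖(y : ℂ) * Complex.I‖ ^ 2 = y ^ 2 := by simp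
    rw [h3] at h2
    linarith [sq_nonneg y]
  · have h1 : ‖Complex.exp (Complex.I * y) - 1‖ ≤ ‖y‖ := Real.norm_exp_I_mul_ofReal_sub_one_le
    rw [mul_comm] at h1
    refine (norm_sub_le _ _).trans ?_
    have h2 : ‖(y : ℂ) * Complex.I‖ = |y| := by simp
    rw [h2]
    rw [Real.norm_eq_abs] at h1
    rw [← sq_abs]
    nlinarith

end Deterministic

/-! ### The empirical characteristic function and its recursion -/

section CharSum

variable {Ω : Type*} {X : ℕ → Ω → ℤ}

/-- The sum of `exp (i θ X_k)` over the first `n` labels. -/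
noncomputable def charSum (X : ℕ → Ω → ℤ) (n : ℕ) (ω : Ω) (θ : ℝ) : ℂ :=
  ∑ k ∈ Finset.range n, Complex.exp ((θ * X k ω : ℝ) * Complex.I)

lemma charSum_succ (X : ℕ → Ω → ℤ) (n : ℕ) (ω : Ω) (θ : ℝ) :
    charSum X (n + 1) ω θ = charSum X n ω θ + Complex.exp ((θ * X n ω : ℝ) * Complex.I) :=
  Finset.sum_range_succ _ _

lemma norm_charSum_le (X : ℕ → Ω → ℤ) (n : ℕ) (ω : Ω) (θ : ℝ) : ‖charSum X n ω θ‖ ≤ n := by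
  refine (norm_sum_le_of_le _ fun k _ => (Complex.norm_exp_ofReal_mul_I _).le).trans ?_
  simp

/-- The sum of two independent draws has the squared characteristic function. Real and imaginary
parts are kept apart because the noise bounds are for real test functions. -/
lemma pairMean_cos_add_sin (X : ℕ → Ω → ℤ) (n : ℕ) (ω : Ω) (θ : ℝ) :
    (pairMean (fun z => Real.cos (θ * z)) X n ω : ℂ)
      + pairMean (fun z => Real.sin (θ * z)) X n ω * Complex.I = (charSum X n ω θ / n) ^ 2 := by
  have h : ∀ z w : ℤ, (Real.cos (θ * (z + w : ℤ)) : ℂ) + Real.sin (θ * (z + w : ℤ)) * Complex.I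
      = Complex.exp ((θ * z : ℝ) * Complex.I) * Complex.exp ((θ * w : ℝ) * Complex.I) := by
    intro z w
    rw [← Complex.exp_add, ← add_mul, ← Complex.ofReal_add, Complex.exp_mul_I,
      ← Complex.ofReal_cos, ← Complex.ofReal_sin]
    push_cast
    ring_nf
  simp only [pairMean, charSum, Complex.ofReal_mul, Complex.ofReal_inv, Complex.ofReal_natCast,
    Complex.ofReal_sum]
  rw [div_pow, sq (∑ k ∈ Finset.range n, _), Finset.sum_mul_sum]
  simp only [← Complex.ofReal_mul, ← h, Finset.sum_add_distrib, ← Finset.mul_sum,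
    ← Finset.sum_mul]
  ring

lemma norm_charSum_sub_le (X : ℕ → Ω → ℤ) (n : ℕ) (ω : Ω) (θ θ' : ℝ) :
    ‖charSum X n ω θ - charSum X n ω θ'‖ ≤ |θ - θ'| * total (fun z => |(z : ℝ)|) X n ω := by
  rw [charSum, charSum, ← Finset.sum_sub_distrib, total, Finset.mul_sum]
  refine (norm_sum_le _ _).trans (Finset.sum_le_sum fun k _ => ?_)
  have e : Complex.exp ((θ * X k ω : ℝ) * Complex.I) - Complex.exp ((θ' * X k ω : ℝ) * Complex.I)
      = Complex.exp ((θ' * X k ω : ℝ) * Complex.I)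
        * (Complex.exp (Complex.I * (((θ - θ') * X k ω : ℝ))) - 1) := by
    rw [mul_sub, ← Complex.exp_add]
    push_cast
    ring_nf
  rw [e, norm_mul, Complex.norm_exp_ofReal_mul_I, one_mul, ← abs_mul]
  exact Real.norm_exp_I_mul_ofReal_sub_one_le

/-- The initial distance to the limiting characteristic function. -/
lemma norm_charSum_sub_expChar_le (X : ℕ → Ω → ℤ) (m : ℕ) (ω : Ω) (a θ : ℝ) :
    ‖charSum X m ω θ - m * expChar a (θ * m)‖ ≤
      2 * θ ^ 2 * total (fun z => (z : ℝ) ^ 2) X m ω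
        + |θ| * |total (fun z => (z : ℝ)) X m ω - a * m ^ 2| + a ^ 2 * θ ^ 2 * m ^ 3 := by
  -- The expansion `p = 1 + z + z ^ 2 p` with `z = i a θ m` is exact for `p = 1 / (1 - z)`; its
  -- linear term is set against that of the exponentials.
  have e : charSum X m ω θ - m * expChar a (θ * m)
      = (∑ k ∈ Finset.range m, (Complex.exp ((θ * X k ω : ℝ) * Complex.I) - 1
          - (θ * X k ω : ℝ) * Complex.I))
        + ((θ * (total (fun z => (z : ℝ)) X m ω - a * m ^ 2) : ℝ) : ℂ) * Complex.I
        + ((a ^ 2 * θ ^ 2 * m ^ 3 : ℝ) : ℂ) * expChar a (θ * m) := by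
    have h := expChar_mul a (θ * m)
    generalize expChar a (θ * m) = p at h ⊢
    have h1 : ((∑ k ∈ Finset.range m, ((X k ω : ℤ) : ℝ) : ℝ) : ℂ) * θ
        = ∑ k ∈ Finset.range m, ((θ * X k ω : ℝ) : ℂ) := by
      push_cast
      rw [Finset.sum_mul]
      simp_rw [mul_comm]
    simp only [charSum, total, Finset.sum_sub_distrib, ← Finset.sum_mul,
      Finset.sum_const, Finset.card_range, nsmul_eq_mul, Complex.ofReal_mul, Complex.ofReal_sub,
      Complex.ofReal_pow, Complex.ofReal_natCast] at h h1 ⊢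
    linear_combination -(m : ℂ) * (1 + a * θ * Complex.I * m) * h
      - a ^ 2 * θ ^ 2 * m ^ 3 * p * Complex.I_sq - Complex.I * h1
  rw [e]
  refine (norm_add_le _ _).trans (add_le_add ((norm_add_le _ _).trans (add_le_add ?_ ?_)) ?_)
  · rw [total, Finset.mul_sum]
    refine (norm_sum_le _ _).trans (Finset.sum_le_sum fun k _ => ?_)
    refine (norm_exp_mul_I_sub_sub_le _).trans (le_of_eq (by ring))
  · rw [norm_mul, Complex.norm_I, mul_one, Complex.norm_real, Real.norm_eq_abs, abs_mul]
  · rw [norm_mul, Complex.norm_real, Real.norm_of_nonneg (by positivity)]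
    exact mul_le_of_le_one_right (by positivity) (norm_expChar_le _ _)

/-- Comparison of the empirical characteristic function with the exponential one, given bounds
on the noise. -/
lemma norm_charSum_sub_expChar_le_of_noise {τ m N : ℕ} (hτm : τ ≤ m) (hm : 0 < m) (hmN : m ≤ N)
    (ω : Ω) (a θ u : ℝ)
    (hcos : ∀ n, τ ≤ n → n ≤ N → |noise (fun z => Real.cos (θ * z)) X τ n ω| ≤ u)
    (hsin : ∀ n, τ ≤ n → n ≤ N → |noise (fun z => Real.sin (θ * z)) X τ n ω| ≤ u) :
    ‖charSum X N ω θ - N * expChar a (θ * N)‖ ≤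
      (2 * θ ^ 2 * total (fun z => (z : ℝ) ^ 2) X m ω
        + |θ| * |total (fun z => (z : ℝ)) X m ω - a * m ^ 2| + a ^ 2 * θ ^ 2 * m ^ 3
        + 4 * u + N * (|a * θ| * (1 + N * |a * θ|))) * ((N : ℝ) * (N + 1) / (m * (m + 1))) := by
  set ξ : ℕ → ℂ := fun n =>
    ((Real.cos (θ * X n ω) - pairMean (fun z => Real.cos (θ * z)) X n ω : ℝ) : ℂ)
      + ((Real.sin (θ * X n ω) - pairMean (fun z => Real.sin (θ * z)) X n ω : ℝ) : ℂ) * Complex.I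
    with hξ
  set η : ℕ → ℂ := fun n => ((n : ℂ) + 1) * expChar a (θ * (n + 1)) - n * expChar a (θ * n)
    - expChar a (θ * n) ^ 2 with hη
  -- The difference of the squares `(charSum / n) ^ 2` and `expChar ^ 2` factors, so the coefficient
  -- `c` is a sum of two numbers of norm at most `1`.
  refine norm_le_of_recursion (E := fun n => charSum X n ω θ - n * expChar a (θ * n))
    (c := fun n => charSum X n ω θ / n + expChar a (θ * n)) (d := fun n => ξ n - η n)
    hm ?_ ?_ ?_ hmN le_rfl
  · intro n hmn _
    have hn0 : (n : ℂ) ≠ 0 := by exact_mod_cast (by omega : n ≠ 0)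
    have h1 := pairMean_cos_add_sin X n ω θ
    have h2 : ξ n = Complex.exp ((θ * X n ω : ℝ) * Complex.I) - (charSum X n ω θ / n) ^ 2 := by
      rw [← h1, Complex.exp_mul_I, ← Complex.ofReal_cos, ← Complex.ofReal_sin, hξ]
      push_cast
      ring
    simp only [h2, hη, charSum_succ]
    push_cast
    field_simp
    ring
  · intro n hmn _
    have hn0 : (0 : ℝ) < n := by exact_mod_cast (by omega : 0 < n)
    have h1 : ‖charSum X n ω θ / n‖ ≤ 1 := by
      rw [norm_div, Complex.norm_natCast, div_le_one hn0]
      exact norm_charSum_le X n ω θ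
    exact (norm_add_le _ _).trans (by linarith [norm_expChar_le a (θ * n)])
  · intro n hmn hnN
    have h0 := norm_charSum_sub_expChar_le X m ω a θ
    have hsplit : ∀ g : ℤ → ℝ, ∑ k ∈ Finset.Ico m n, (g (X k ω) - pairMean g X k ω)
        = noise g X τ n ω - noise g X τ m ω := by
      intro g
      rw [noise, noise, ← Finset.sum_Ico_consecutive _ hτm hmn]
      ring
    -- Four noise terms: cosine and sine, each at the two ends `m` and `n`.
    have h1 : ‖∑ k ∈ Finset.Ico m n, ξ k‖ ≤ 4 * u := by
      simp only [hξ, Finset.sum_add_distrib, ← Finset.sum_mul, ← Complex.ofReal_sum]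
      rw [hsplit fun z => Real.cos (θ * z), hsplit fun z => Real.sin (θ * z)]
      refine (norm_add_le _ _).trans ?_
      rw [norm_mul, Complex.norm_I, mul_one, Complex.norm_real, Complex.norm_real,
        Real.norm_eq_abs, Real.norm_eq_abs]
      have b1 := abs_sub (noise (fun z => Real.cos (θ * z)) X τ n ω)
        (noise (fun z => Real.cos (θ * z)) X τ m ω)
      have b2 := abs_sub (noise (fun z => Real.sin (θ * z)) X τ n ω)
        (noise (fun z => Real.sin (θ * z)) X τ m ω)
      have := hcos n (by omega) hnN
      have := hcos m (by omega) hmN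
      have := hsin n (by omega) hnN
      have := hsin m (by omega) hmN
      linarith
    have h2 : ‖∑ k ∈ Finset.Ico m n, η k‖ ≤ N * (|a * θ| * (1 + N * |a * θ|)) := by
      have hk : ∀ k ∈ Finset.Ico m n, ‖η k‖ ≤ |a * θ| * (1 + N * |a * θ|) := by
        intro k hk
        refine (norm_expChar_recursion_le a θ k).trans ?_
        have : (k : ℝ) ≤ N := by
          exact_mod_cast (Finset.mem_Ico.1 hk).2.le.trans hnN
        gcongr
      refine (norm_sum_le_of_le _ hk).trans ?_
      rw [Finset.sum_const, nsmul_eq_mul, Nat.card_Ico]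
      have : ((n - m : ℕ) : ℝ) ≤ N := by exact_mod_cast (by omega : n - m ≤ N)
      gcongr
    rw [Finset.sum_sub_distrib]
    have h3 := norm_add_le (charSum X m ω θ - m * expChar a (θ * m))
      (∑ k ∈ Finset.Ico m n, ξ k - ∑ k ∈ Finset.Ico m n, η k)
    have h4 := norm_sub_le (∑ k ∈ Finset.Ico m n, ξ k) (∑ k ∈ Finset.Ico m n, η k)
    linarith

end CharSum

/-! ### The intermediate time scale -/

section Scale

/-- The integer part of the twentieth root. -/
noncomputable def rootScale (N : ℕ) : ℕ := ⌊(N : ℝ) ^ (1 / 20 : ℝ)⌋₊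

lemma tendsto_rootScale : Tendsto rootScale atTop atTop :=
  tendsto_nat_floor_atTop.comp
    ((tendsto_rpow_atTop (by norm_num)).comp tendsto_natCast_atTop_atTop)

lemma rootScale_pow_le (N : ℕ) : (rootScale N : ℝ) ^ 20 ≤ N := by
  have h : (rootScale N : ℝ) ≤ (N : ℝ) ^ (1 / 20 : ℝ) := Nat.floor_le (by positivity)
  have h20 : ((N : ℝ) ^ (1 / 20 : ℝ)) ^ 20 = N := by
    rw [← Real.rpow_natCast, ← Real.rpow_mul (by positivity)]
    norm_num
  exact (pow_le_pow_left₀ (Nat.cast_nonneg _) h 20).trans_eq h20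

lemma le_two_mul_rootScale_pow {N : ℕ} (h : 1 ≤ rootScale N) :
    (N : ℝ) ≤ (2 * rootScale N) ^ 20 := by
  have h1 : (1 : ℝ) ≤ rootScale N := by exact_mod_cast h
  calc (N : ℝ) = ((N : ℝ) ^ (1 / 20 : ℝ)) ^ 20 := by
        rw [← Real.rpow_natCast, ← Real.rpow_mul (by positivity)]
        norm_num
    _ ≤ (2 * rootScale N) ^ 20 := by
        gcongr
        have := (Nat.lt_floor_add_one ((N : ℝ) ^ (1 / 20 : ℝ))).le
        change _ ≤ (rootScale N : ℝ) + 1 at this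
        linarith

end Scale

/-! ### Pointwise convergence of the characteristic functions -/

section Limit

variable {Ω : Type*} {X : ℕ → Ω → ℤ} {ω : Ω} {a : ℝ}

lemma tendsto_total_div_sq
    (h : Tendsto (fun n => scaledTotal (fun z => (z : ℝ)) X n ω) atTop (𝓝 a)) :
    Tendsto (fun n : ℕ => total (fun z => (z : ℝ)) X n ω / (n : ℝ) ^ 2) atTop (𝓝 a) := by
  have h1 : Tendsto (fun n : ℕ => 1 + ((n : ℝ))⁻¹) atTop (𝓝 (1 + 0)) :=
    tendsto_const_nhds.add tendsto_inv_atTop_nhds_zero_nat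
  have h2 := h.mul h1
  rw [add_zero, mul_one] at h2
  refine h2.congr' ?_
  filter_upwards [eventually_gt_atTop 0] with n hn
  have : (0 : ℝ) < n := by exact_mod_cast hn
  simp only [scaledTotal]
  field_simp

/-- The rescaled empirical characteristic function converges at `t`, as soon as the means
converge and the second moments and the noise are small enough. -/
lemma tendsto_charSum_div {τ : ℕ} (t : ℝ)
    (hS : Tendsto (fun n => scaledTotal (fun z => (z : ℝ)) X n ω) atTop (𝓝 a))
    (hQ : Tendsto (fun K : ℕ => total (fun z => (z : ℝ) ^ 2) X (K ^ 18) ω / (K : ℝ) ^ 56)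
      atTop (𝓝 0))
    (hcos : ∀ᶠ N : ℕ in atTop, ∀ n, τ ≤ n → n ≤ N →
      |noise (fun z => Real.cos (t / N * z)) X τ n ω| < √N * √√N)
    (hsin : ∀ᶠ N : ℕ in atTop, ∀ n, τ ≤ n → n ≤ N →
      |noise (fun z => Real.sin (t / N * z)) X τ n ω| < √N * √√N) :
    Tendsto (fun N : ℕ => charSum X N ω (t / N) / N) atTop (𝓝 (expChar a t)) := by
  set q : ℕ → ℝ := fun K => total (fun z => (z : ℝ) ^ 2) X (K ^ 18) ω / (K : ℝ) ^ 56
  set s : ℕ → ℝ := fun n => total (fun z => (z : ℝ)) X n ω / (n : ℝ) ^ 2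
  -- With `K` about `N ^ (1 / 20)` and `m = K ^ 18`, the amplification `(N / m) ^ 2` is of order `K
  -- ^ 4`. It turns the noise `N ^ (3 / 4)`, of order `K ^ 15`, into `K ^ 19`, which is small
  -- against `N`. The five terms come from the second moment, the mean and the quadratic remainder
  -- at time `m`, the noise, and the Euler steps. The powers of `2` come from `N ≤ (2 K) ^ 20`.
  set err : ℕ → ℝ := fun K => 4 * t ^ 2 * q K + 2 * |t| * |s (K ^ 18) - a|
    + 2 * a ^ 2 * t ^ 2 * (K : ℝ)⁻¹ + 8 * 2 ^ 35 * (K : ℝ)⁻¹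
    + 2 * (|a * t| * (1 + |a * t|)) * 2 ^ 20 * (K : ℝ)⁻¹ with herr
  have herr0 : Tendsto err atTop (𝓝 0) := by
    have h1 : Tendsto (fun K : ℕ => |s (K ^ 18) - a|) atTop (𝓝 0) := by
      have h2 : Tendsto (fun K : ℕ => K ^ 18) atTop atTop := tendsto_pow_atTop (by norm_num)
      have h3 := (((tendsto_total_div_sq hS).comp h2).sub_const a).abs
      rw [sub_self, abs_zero] at h3
      exact h3
    have h4 : Tendsto (fun K : ℕ => (K : ℝ)⁻¹) atTop (𝓝 0) := tendsto_inv_atTop_nhds_zero_nat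
    have h5 := ((((hQ.const_mul (4 * t ^ 2)).add (h1.const_mul (2 * |t|))).add
      (h4.const_mul (2 * a ^ 2 * t ^ 2))).add (h4.const_mul (8 * 2 ^ 35))).add
      (h4.const_mul (2 * (|a * t| * (1 + |a * t|)) * 2 ^ 20))
    simpa only [mul_zero, add_zero] using h5
  rw [tendsto_iff_norm_sub_tendsto_zero]
  refine squeeze_zero' (Eventually.of_forall fun _ => norm_nonneg _) ?_
    (herr0.comp tendsto_rootScale)
  filter_upwards [hcos, hsin, tendsto_rootScale.eventually_ge_atTop (τ + 1)] with N h1 h2 h3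
  set K := rootScale N with hK
  have hK1 : (1 : ℝ) ≤ K := by exact_mod_cast (by omega : 1 ≤ K)
  have hK0 : (0 : ℝ) < K := by linarith
  have hKN : (K : ℝ) ^ 20 ≤ N := rootScale_pow_le N
  have hNK : (N : ℝ) ≤ (2 * K) ^ 20 := le_two_mul_rootScale_pow (by omega)
  have hN0 : (0 : ℝ) < N := lt_of_lt_of_le (by positivity) hKN
  have hN1 : (1 : ℝ) ≤ N := le_trans (one_le_pow₀ hK1) hKN
  have hτm : τ ≤ K ^ 18 := (by omega : τ ≤ K).trans (Nat.le_self_pow (by norm_num) K)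
  have hm0 : 0 < K ^ 18 := Nat.pow_pos (by omega)
  have hmN : K ^ 18 ≤ N := by
    have : (K : ℝ) ^ 18 ≤ N := (pow_le_pow_right₀ hK1 (by norm_num)).trans hKN
    exact_mod_cast this
  have key := norm_charSum_sub_expChar_le_of_noise (X := X) hτm hm0 hmN ω a (t / N) (√N * √√N)
    (fun n hn hn' => (h1 n hn hn').le) (fun n hn hn' => (h2 n hn hn').le)
  have e1 : charSum X N ω (t / N) / N - expChar a t
      = (charSum X N ω (t / N) - N * expChar a (t / N * N)) / N := by
    have : (N : ℂ) ≠ 0 := by exact_mod_cast hN0.ne'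
    rw [div_mul_cancel₀ _ hN0.ne']
    field_simp
  rw [e1, norm_div, Complex.norm_natCast, div_le_iff₀ hN0]
  refine key.trans ?_
  have eQ : total (fun z => (z : ℝ) ^ 2) X (K ^ 18) ω = q K * K ^ 56 := by
    simp only [q]; field_simp
  have eS : |total (fun z => (z : ℝ)) X (K ^ 18) ω - a * ((K ^ 18 : ℕ) : ℝ) ^ 2|
      = |s (K ^ 18) - a| * K ^ 36 := by
    have : total (fun z => (z : ℝ)) X (K ^ 18) ω - a * ((K ^ 18 : ℕ) : ℝ) ^ 2
        = (s (K ^ 18) - a) * K ^ 36 := by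
      simp only [s]; push_cast; field_simp
    rw [this, abs_mul, abs_of_pos (by positivity : (0 : ℝ) < K ^ 36)]
  have hq0 : 0 ≤ q K := div_nonneg (Finset.sum_nonneg fun i _ => sq_nonneg _) (by positivity)
  rw [eQ, eS]
  set r := |s (K ^ 18) - a| with hr
  have hr0 : 0 ≤ r := abs_nonneg _
  have eat : |a * (t / N)| = |a * t| / N := by
    rw [← mul_div_assoc, abs_div, abs_of_pos hN0]
  have et : |t / N| = |t| / N := by rw [abs_div, abs_of_pos hN0]
  rw [eat, et]
  have hu : √(N : ℝ) * √√N ≤ (2 * K) ^ 15 := by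
    have h1 : √(N : ℝ) ≤ (2 * K) ^ 10 := by
      rw [Real.sqrt_le_left (by positivity), ← pow_mul]; exact hNK
    have h2 : √√(N : ℝ) ≤ (2 * K) ^ 5 := by
      rw [Real.sqrt_le_left (by positivity), ← pow_mul]; exact h1
    calc _ ≤ (2 * (K : ℝ)) ^ 10 * (2 * K) ^ 5 := by gcongr
      _ = _ := by ring
  have hfac : (N : ℝ) * (N + 1) / (((K ^ 18 : ℕ) : ℝ) * (((K ^ 18 : ℕ) : ℝ) + 1))
      ≤ N * (2 * N / K ^ 36) := by
    push_cast
    rw [mul_div_assoc]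
    gcongr ?_ * ?_
    rw [div_le_div_iff₀ (by positivity) (by positivity)]
    have : (0 : ℝ) ≤ K ^ 18 := by positivity
    calc ((N : ℝ) + 1) * (K : ℝ) ^ 36 ≤ (2 * N) * (K : ℝ) ^ 36 := by gcongr; linarith
      _ ≤ 2 * N * ((K : ℝ) ^ 18 * ((K : ℝ) ^ 18 + 1)) := by gcongr; nlinarith
  set c := |a * t| with hc
  have hc0 : 0 ≤ c := abs_nonneg _
  calc _ ≤ (2 * (t / N) ^ 2 * (q K * K ^ 56) + |t| / N * (r * K ^ 36)
        + a ^ 2 * (t / N) ^ 2 * ((K ^ 18 : ℕ) : ℝ) ^ 3 + 4 * (2 * K) ^ 15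
        + N * (c / N * (1 + N * (c / N)))) * (N * (2 * N / K ^ 36)) := by gcongr
    _ = (4 * t ^ 2 * q K * (K ^ 20 / N) + 2 * |t| * r
        + 2 * a ^ 2 * t ^ 2 * (K ^ 18 / N) + 8 * 2 ^ 15 * (N / K ^ 21)
        + 2 * (c * (1 + c)) * (N / K ^ 36)) * N := by
      push_cast
      field_simp
      ring
    _ ≤ err K * N := by
      have b1 : (K : ℝ) ^ 20 / N ≤ 1 := (div_le_one hN0).2 hKN
      have b2 : (K : ℝ) ^ 18 / N ≤ (K : ℝ)⁻¹ := by
        rw [div_le_iff₀ hN0, inv_mul_eq_div, le_div_iff₀ hK0, ← pow_succ]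
        exact (pow_le_pow_right₀ hK1 (by norm_num)).trans hKN
      have b3 : (N : ℝ) / K ^ 21 ≤ 2 ^ 20 * (K : ℝ)⁻¹ := by
        rw [div_le_iff₀ (by positivity)]
        refine hNK.trans (le_of_eq ?_)
        field_simp
      have b4 : (N : ℝ) / K ^ 36 ≤ 2 ^ 20 * (K : ℝ)⁻¹ := by
        refine le_trans ?_ b3
        gcongr
        · norm_num
      rw [herr]
      have c1 : 4 * t ^ 2 * q K * (K ^ 20 / N) ≤ 4 * t ^ 2 * q K * 1 := by gcongr
      have c2 : 2 * a ^ 2 * t ^ 2 * ((K : ℝ) ^ 18 / N) ≤ 2 * a ^ 2 * t ^ 2 * (K : ℝ)⁻¹ := by gcongr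
      have c4 : 2 * (c * (1 + c)) * ((N : ℝ) / K ^ 36)
        ≤ 2 * (c * (1 + c)) * (2 ^ 20 * (K : ℝ)⁻¹) := by gcongr
      gcongr
      linarith

/-- Pointwise convergence on a dense set and an equi-Lipschitz bound give pointwise convergence
everywhere. -/
lemma tendsto_of_tendsto_rat {f : ℕ → ℝ → ℂ} {g : ℝ → ℂ} (hg : Continuous g) {C : ℝ} {n₀ : ℕ}
    (hf : ∀ n, n₀ ≤ n → ∀ s t, ‖f n s - f n t‖ ≤ C * |s - t|)
    (h : ∀ r : ℚ, Tendsto (fun n => f n r) atTop (𝓝 (g r))) (t : ℝ) :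
    Tendsto (fun n => f n t) atTop (𝓝 (g t)) := by
  rw [Metric.tendsto_atTop]
  intro ε hε
  have h1 : ∀ᶠ s in 𝓝 t, ‖g s - g t‖ < ε / 3 := by
    have := Metric.tendsto_nhds.1 (hg.tendsto t) (ε / 3) (by positivity)
    simpa [dist_eq_norm] using this
  have h2 : ∀ᶠ s in 𝓝 t, C * |t - s| < ε / 3 := by
    have hc : Continuous fun s => C * |t - s| := by fun_prop
    have := hc.tendsto t
    simp only [sub_self, abs_zero, mul_zero] at this
    exact this.eventually_lt_const (by positivity)
  -- A rational `r` so close to `t` that both `g r - g t` and the Lipschitz bound on `f n t - f n r`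
  -- are below `ε / 3`, uniformly in large `n`.
  obtain ⟨r, hr1, hr2⟩ := (Rat.denseRange_cast (𝕜 := ℝ)).exists_mem_open
    (isOpen_interior (s := {s : ℝ | ‖g s - g t‖ < ε / 3 ∧ C * |t - s| < ε / 3}))
    ⟨t, mem_interior_iff_mem_nhds.2 (h1.and h2)⟩ |>.imp fun r hr => interior_subset hr
  obtain ⟨n₁, hn₁⟩ := Metric.tendsto_atTop.1 (h r) (ε / 3) (by positivity)
  refine ⟨max n₀ n₁, fun n hn => ?_⟩
  have h3 := hf n (le_of_max_le_left hn) t r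
  have h4 := hn₁ n (le_of_max_le_right hn)
  rw [dist_eq_norm] at h4 ⊢
  have e : f n t - g t = (f n t - f n r) + (f n r - g r) + (g r - g t) := by ring
  rw [e]
  have h5 := norm_add₃_le (a := f n t - f n r) (b := f n r - g r) (c := g r - g t)
  linarith

end Limit

/-! ### Weak convergence of the empirical measures -/

section Weak

lemma charFun_scaledExp (a t : ℝ) : charFun (scaledExp a) t = expChar a t := by
  rw [scaledExp, charFun_map_mul, charFun_apply_real, expMeasure, gammaMeasure,
    integral_withDensity_eq_integral_toReal_smul (f := gammaPDF 1 1)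
      (measurable_gammaPDFReal 1 1).ennreal_ofReal
      (ae_of_all _ fun _ => ENNReal.ofReal_lt_top)]
  have e : ∀ y : ℝ, (gammaPDF 1 1 y).toReal • Complex.exp ((a * t : ℝ) * y * Complex.I)
      = (Set.Ici (0 : ℝ)).indicator
        (fun y : ℝ => Complex.exp (-(1 - a * t * Complex.I) * y)) y := by
    intro y
    by_cases hy : 0 ≤ y
    · have h1 : gammaPDF 1 1 y = ENNReal.ofReal (Real.exp (-y)) := by
        have := exponentialPDF_of_nonneg (r := 1) hy
        simpa [exponentialPDF, exponentialPDFReal, gammaPDF] using this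
      rw [h1, ENNReal.toReal_ofReal (Real.exp_pos _).le, Set.indicator_of_mem (by exact hy),
        Complex.real_smul, Complex.ofReal_exp, ← Complex.exp_add]
      push_cast
      ring_nf
    · rw [gammaPDF_of_neg (not_le.1 hy), Set.indicator_of_notMem (by exact hy)]
      simp
  simp_rw [e]
  rw [integral_indicator measurableSet_Ici, integral_Ici_eq_integral_Ioi,
    integral_exp_mul_complex_Ioi (by simp)]
  simp only [Complex.ofReal_zero, mul_zero, Complex.exp_zero, expChar]
  rw [neg_div_neg_eq, one_div]

lemma isProbabilityMeasure_scaledExp (a : ℝ) : IsProbabilityMeasure (scaledExp a) := by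
  have := isProbabilityMeasure_expMeasure (r := 1) one_pos
  exact Measure.isProbabilityMeasure_map (by fun_prop)

/-- Lévy's continuity theorem for sequences of laws that are eventually probability measures. -/
lemma weakTendsto_of_tendsto_charFun {ν : ℕ → Measure ℝ} {ν' : Measure ℝ}
    [IsProbabilityMeasure ν'] {n₀ : ℕ} (hν : ∀ n, n₀ ≤ n → IsProbabilityMeasure (ν n))
    (h : ∀ t, Tendsto (fun n => charFun (ν n) t) atTop (𝓝 (charFun ν' t))) :
    WeakTendsto ν ν' := by
  intro f
  -- The shift is needed because the empirical measure of no balls is the zero measure, not a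
  -- probability.
  let μ : ℕ → ProbabilityMeasure ℝ := fun n => ⟨ν (n + n₀), hν _ (by omega)⟩
  let μ' : ProbabilityMeasure ℝ := ⟨ν', inferInstance⟩
  have h1 : Tendsto μ atTop (𝓝 μ') := by
    rw [ProbabilityMeasure.tendsto_iff_tendsto_charFun]
    exact fun t => (tendsto_add_atTop_iff_nat (f := fun n => charFun (ν n) t) n₀).2 (h t)
  have h2 := ProbabilityMeasure.tendsto_iff_forall_integral_tendsto.1 h1 f
  exact (tendsto_add_atTop_iff_nat (f := fun n => ∫ y, f y ∂(ν n)) n₀).1 h2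

variable {Ω : Type*} {X : ℕ → Ω → ℤ}

lemma charFun_map_empirical (n : ℕ) (ω : Ω) (t : ℝ) :
    charFun ((empirical X n ω).map (fun z : ℤ => (z : ℝ) / n)) t = charSum X n ω (t / n) / n := by
  rw [charFun_apply_real, integral_map (measurable_from_top).aemeasurable (by fun_prop),
    integral_empirical, charSum, Complex.real_smul, div_eq_inv_mul]
  push_cast
  congr 1
  refine Finset.sum_congr rfl fun k _ => ?_
  ring_nf

variable [MeasurableSpace Ω] {P : Measure Ω} [IsProbabilityMeasure P]
  {τ : ℕ} {x : Fin τ → ℤ} (hX : IsZUrn P x X) (hτ : 0 < τ)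
include hX hτ

/-- The quenched limit law of the urn. -/
lemma IsZUrn.ae_weakTendsto {A : Ω → ℝ} (hlim : ∀ᵐ ω ∂P,
      Tendsto (fun n => scaledTotal (fun z => (z : ℝ)) X n ω) atTop (𝓝 (A ω))) :
    ∀ᵐ ω ∂P, WeakTendsto (fun n : ℕ => (empirical X n ω).map (fun z : ℤ => (z : ℝ) / n))
      (scaledExp (A ω)) := by
  -- The exceptional null set of the noise bound depends on the frequency, so only countably many
  -- frequencies can be treated at once.
  have hcos : ∀ᵐ ω ∂P, ∀ r : ℚ, ∀ᶠ N : ℕ in atTop, ∀ n, τ ≤ n → n ≤ N →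
      |noise (fun z => Real.cos ((r : ℝ) / N * z)) X τ n ω| < √N * √√N :=
    ae_all_iff.2 fun r => hX.ae_eventually_abs_noise_lt hτ
      (g := fun N z => Real.cos ((r : ℝ) / N * z)) fun _ _ => Real.abs_cos_le_one _
  have hsin : ∀ᵐ ω ∂P, ∀ r : ℚ, ∀ᶠ N : ℕ in atTop, ∀ n, τ ≤ n → n ≤ N →
      |noise (fun z => Real.sin ((r : ℝ) / N * z)) X τ n ω| < √N * √√N :=
    ae_all_iff.2 fun r => hX.ae_eventually_abs_noise_lt hτ
      (g := fun N z => Real.sin ((r : ℝ) / N * z)) fun _ _ => Real.abs_sin_le_one _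
  filter_upwards [hcos, hsin, hlim, hX.ae_tendsto_total_sq hτ,
    hX.ae_exists_scaledTotal_abs_le hτ] with ω h1 h2 h3 h4 ⟨C, h5⟩
  have := isProbabilityMeasure_scaledExp (A ω)
  refine weakTendsto_of_tendsto_charFun (n₀ := 1) (fun n hn => ?_) fun t => ?_
  · have := isProbabilityMeasure_empirical X (by omega : n ≠ 0) ω
    exact Measure.isProbabilityMeasure_map (measurable_from_top).aemeasurable
  simp_rw [charFun_scaledExp, charFun_map_empirical]
  -- The Lipschitz constant is the mean absolute label divided by `n`, at most `(n + 1) C / n ≤ 2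
  -- C`.
  refine tendsto_of_tendsto_rat (f := fun n t => charSum X n ω (t / n) / n)
    (continuous_expChar _) (C := 2 * C) (n₀ := τ) (fun n hn s t => ?_)
    (fun r => tendsto_charSum_div (r : ℝ) h3 h4 (h1 r) (h2 r)) t
  have hn1 : (1 : ℝ) ≤ n := by exact_mod_cast (by omega : 1 ≤ n)
  have hn0 : (0 : ℝ) < n := by linarith
  rw [← sub_div, norm_div, Complex.norm_natCast, div_le_iff₀ hn0]
  refine (norm_charSum_sub_le X n ω _ _).trans ?_
  have h6 := h5 n hn
  rw [scaledTotal, inv_mul_le_iff₀ (by positivity)] at h6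
  have hC : 0 ≤ C := by
    refine le_trans ?_ (h5 n hn)
    exact mul_nonneg (by positivity) (Finset.sum_nonneg fun _ _ => abs_nonneg _)
  rw [← sub_div, abs_div, abs_of_pos hn0, div_mul_eq_mul_div, div_le_iff₀ hn0]
  calc |s - t| * total (fun z => |(z : ℝ)|) X n ω ≤ |s - t| * (n * (n + 1) * C) := by gcongr
    _ ≤ |s - t| * (n * (n + n) * C) := by gcongr
    _ = 2 * C * |s - t| * n * n := by ring

end Weak

/-! ### Draws on the probability space of the urn -/

section Draw

variable {Ω : Type*} [MeasurableSpace Ω]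

lemma measurable_empirical {X : ℕ → Ω → ℤ} (hX : ∀ i, Measurable (X i)) (n : ℕ) :
    Measurable (empirical X n) := by
  refine Measure.measurable_of_measurable_coe _ fun s hs => ?_
  simp only [empirical, Measure.smul_apply, Measure.finsetSum_apply, smul_eq_mul]
  refine (Finset.measurable_sum _ fun i _ => ?_).const_mul _
  exact (Measure.measurable_coe hs).comp (Measure.measurable_dirac.comp (hX i))

omit [MeasurableSpace Ω] in
lemma sum_mul_empirical_real {X : ℕ → Ω → ℤ} {n B : ℕ} {ω : Ω} (h : ∀ i < n, |X i ω| ≤ B)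
    (g : ℤ → ℝ) : ∑ z ∈ Finset.Icc (-(B : ℤ)) B, g z * (empirical X n ω).real {z}
      = ∫ z, g z ∂(empirical X n ω) := by
  classical
  rw [integral_empirical, smul_eq_mul, Finset.mul_sum]
  simp_rw [empirical_real, Finset.mul_sum]
  rw [Finset.sum_comm]
  refine Finset.sum_congr rfl fun i hi => ?_
  rw [Finset.sum_eq_single (X i ω)]
  · simp; ring
  · intro z _ hz
    simp [hz.symm]
  · intro hh
    exact absurd (Finset.mem_Icc.2 (abs_le.1 (h i (Finset.mem_range.1 hi)))) hh

omit [MeasurableSpace Ω] in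
lemma empirical_real_singleton_eq_zero {X : ℕ → Ω → ℤ} {n B : ℕ} {ω : Ω}
    (h : ∀ i < n, |X i ω| ≤ B) {z : ℤ} (hz : (B : ℤ) < |z|) :
    (empirical X n ω).real {z} = 0 := by
  classical
  rw [empirical_real, Finset.sum_eq_zero, mul_zero]
  intro i hi
  refine if_neg ?_
  rintro rfl
  exact absurd (h i (Finset.mem_range.1 hi)) (not_le.2 hz)

variable {P : Measure Ω} [IsProbabilityMeasure P]
  {τ : ℕ} {x : Fin τ → ℤ} {X Z : ℕ → Ω → ℤ} (hX : IsZUrn P x X) (hZ : IsDraw P τ X Z) (hτ : 0 < τ)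
include hX hZ hτ

lemma IsDraw.exists_bound {n : ℕ} (hn : τ ≤ n) : ∃ B : ℕ, ∀ᵐ ω ∂P, |Z n ω| ≤ B ∧
    ∀ i < n, |X i ω| ≤ B := by
  obtain ⟨B, hB⟩ := hX.exists_bound_lt hτ n
  have h := ae_abs_le_of_condExp_atoms (measurable_empirical hX.measurable n).comap_le
    (hZ.measurable n) (q := fun ω z => (empirical X n ω).real {z}) (hZ.law n hn) (B := B)
    fun z hz => by
      filter_upwards [hB] with ω hω using empirical_real_singleton_eq_zero hω hz
  exact ⟨B, h.and hB⟩

lemma IsDraw.integrable {n : ℕ} (hn : τ ≤ n) : Integrable (fun ω => (Z n ω : ℝ)) P := by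
  obtain ⟨B, hB⟩ := hZ.exists_bound hX hτ hn
  refine Integrable.of_bound (C := B)
    ((measurable_from_top (f := fun z : ℤ => (z : ℝ))).comp
      (hZ.measurable n)).aestronglyMeasurable ?_
  filter_upwards [hB] with ω hω
  rw [Real.norm_eq_abs]
  exact_mod_cast hω.1

lemma IsDraw.condExp_eq {n : ℕ} (hn : τ ≤ n) :
    P[fun ω => (Z n ω : ℝ) | empiricalSigma X n] =ᵐ[P]
      fun ω => ∫ z, (z : ℝ) ∂(empirical X n ω) := by
  obtain ⟨B, hB⟩ := hZ.exists_bound hX hτ hn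
  refine (condExp_comp_of_atoms (hZ.measurable n) (hZ.law n hn)
    (hB.mono fun ω hω => hω.1) fun z => (z : ℝ)).trans ?_
  filter_upwards [hB] with ω hω using sum_mul_empirical_real hω.2 _

/-- A law on `ℤ` is determined by its countably many atoms, so the atomwise almost sure identities
hold simultaneously and identify the whole conditional law; the division by `n` is a pushforward. -/
lemma IsDraw.condDistrib_eq {n : ℕ} (hn : τ ≤ n) : ∀ᵐ ω ∂P,
    condDistrib (fun ω' => (Z n ω' : ℝ) / n) (empirical X n) P (empirical X n ω)
      = (empirical X n ω).map (fun z : ℤ => (z : ℝ) / n) := by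
  have hm := measurable_empirical hX.measurable n
  have hf : Measurable (fun z : ℤ => (z : ℝ) / n) := measurable_from_top
  have h1 : ∀ᵐ ω ∂P, ∀ z : ℤ, (condDistrib (Z n) (empirical X n) P (empirical X n ω)).real {z}
      = (empirical X n ω).real {z} := by
    rw [ae_all_iff]
    intro z
    exact (condDistrib_ae_eq_condExp hm (hZ.measurable n) (measurableSet_singleton z)).trans
      (hZ.law n hn z)
  have h2 := ae_of_ae_map hm.aemeasurable
    (condDistrib_comp (empirical X n) (μ := P) (hZ.measurable n).aemeasurable hf)
  filter_upwards [h1, h2] with ω h1 h2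
  have e : (fun z : ℤ => (z : ℝ) / n) ∘ Z n = fun ω' => (Z n ω' : ℝ) / n := rfl
  rw [e] at h2
  rw [h2, Kernel.map_apply _ hf]
  congr 1
  have := isProbabilityMeasure_empirical X (by omega : n ≠ 0) ω
  refine Measure.ext_of_singleton fun z => ?_
  exact (measureReal_eq_measureReal_iff).1 (h1 z)

end Draw

end ZUrn

/-! ### The main theorem -/

theorem theorem1 {Ω : Type*} [MeasurableSpace Ω] (P : Measure Ω) [IsProbabilityMeasure P]
    (τ : ℕ) (hτ : 0 < τ) (x : Fin τ → ℤ) (X : ℕ → Ω → ℤ) (hX : ZUrn.IsZUrn P x X) :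
    ∃ A : Ω → ℝ, Measurable A ∧
      -- for almost every realization of the urn, the rescaled means of `μ_n` converge to `A`
      (∀ᵐ ω ∂P, Tendsto (fun n : ℕ => (∫ z, (z : ℝ) ∂(ZUrn.empirical X n ω)) / ((n : ℝ) + 1))
        atTop (𝓝 (A ω))) ∧
      ((∃ i, x i ≠ 0) → 0 < P {ω | A ω ≠ 0}) ∧
      -- for almost every realization of the urn, the law of `Z_n / n` for a draw `Z_n` from the
      -- fixed measure `μ_n` converges weakly
      (∀ᵐ ω ∂P, ZUrn.WeakTendsto
        (fun n : ℕ => (ZUrn.empirical X n ω).map (fun z : ℤ => (z : ℝ) / n))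
        (ZUrn.scaledExp (A ω))) ∧
      -- the same for draws `Z n` on the probability space of the urn, with conditional
      -- expectations and conditional distributions given `μ_n`
      (∀ Z : ℕ → Ω → ℤ, ZUrn.IsDraw P τ X Z →
        (∀ n, τ ≤ n → Integrable (fun ω => (Z n ω : ℝ)) P) ∧
        (∀ᵐ ω ∂P, Tendsto
          (fun n : ℕ => (P[fun ω' => (Z n ω' : ℝ) | ZUrn.empiricalSigma X n]) ω / ((n : ℝ) + 1))
          atTop (𝓝 (A ω))) ∧
        (∀ᵐ ω ∂P, ZUrn.WeakTendsto
          (fun n : ℕ => condDistrib (fun ω' => (Z n ω' : ℝ) / n) (ZUrn.empirical X n) P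
            (ZUrn.empirical X n ω))
          (ZUrn.scaledExp (A ω)))) := by
  have hmean : ∀ n ω, (∫ z, (z : ℝ) ∂(ZUrn.empirical X n ω)) / ((n : ℝ) + 1)
      = ZUrn.scaledTotal (fun z => (z : ℝ)) X n ω := by
    intro n ω
    rw [ZUrn.integral_empirical, ZUrn.scaledTotal, ZUrn.total, smul_eq_mul, mul_inv]
    ring
  obtain ⟨A, hA, hlim⟩ := hX.exists_limit hτ
  refine ⟨A, hA, ?_, hX.limit_ne_zero hτ hlim, hX.ae_weakTendsto hτ hlim,
    fun Z hZ => ⟨fun n hn => hZ.integrable hX hτ hn, ?_, ?_⟩⟩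
  · simp_rw [hmean]
    exact hlim
  · have h : ∀ᵐ ω ∂P, ∀ n, τ ≤ n →
        (P[fun ω' => (Z n ω' : ℝ) | ZUrn.empiricalSigma X n]) ω / ((n : ℝ) + 1)
          = ZUrn.scaledTotal (fun z => (z : ℝ)) X n ω := by
      refine ae_all_iff.2 fun n => ?_
      by_cases hn : τ ≤ n
      · filter_upwards [hZ.condExp_eq hX hτ hn] with ω hω _
        rw [hω, hmean]
      · exact ae_of_all _ fun ω h => absurd h hn
    -- The identification of the conditional mean is available only for `n ≥ τ`, which suffices for
    -- a limit.
    filter_upwards [h, hlim] with ω h1 h2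
    refine h2.congr' ?_
    filter_upwards [eventually_ge_atTop τ] with n hn using (h1 n hn).symm
  · have h : ∀ᵐ ω ∂P, ∀ n, τ ≤ n →
        condDistrib (fun ω' => (Z n ω' : ℝ) / n) (ZUrn.empirical X n) P (ZUrn.empirical X n ω)
          = (ZUrn.empirical X n ω).map (fun z : ℤ => (z : ℝ) / n) := by
      refine ae_all_iff.2 fun n => ?_
      by_cases hn : τ ≤ n
      · filter_upwards [hZ.condDistrib_eq hX hτ hn] with ω hω _ using hω
      · exact ae_of_all _ fun ω h => absurd h hn
    filter_upwards [h, hX.ae_weakTendsto hτ hlim] with ω h1 h2 f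
    refine (h2 f).congr' ?_
    filter_upwards [eventually_ge_atTop τ] with n hn
    rw [h1 n hn]
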